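/- Let $\mathcal P$ be the Poisson point process with unit intensity (with respect to Lebesgue measure) in the quadrant $\mathbb R_+^2$, regarded as a random locally finite set, and interpret an atom $(t,x)\in\mathcal P$ as the value $x$ observed at time $t$. For an integer $k\ge 1$ and $t>0$ let $M_t^{(k)}$ be the $k$-th smallest of the values $x$ of the atoms $(s,x)\in\mathcal P$ with $s\le t$. For $j\ge 1$ let $\mathcal R^{(j)}$ be the set of $j$-records, that is, of those atoms $a\in\mathcal P$ for which there are exactly $j-1$ atoms of $\mathcal P$ strictly south-west of $a$ (smaller in both coordinates), and let $\tau(\mathcal R^{(j)})$ be the set of their times (the projection of $\mathcal R^{(j)}$ to the first coordinate). Fix $k\ge 1$ and $t>0$. Then, conditionally given the path $(M_s^{(k)},\,0<s\le t)$, the vector $(M_t^{(1)},\dots,M_t^{(k-1)})$ is independent of the family of random sets of record times $(\tau(\mathcal R^{(j)})\cap[0,t],\ j=1,2,\dots)$. Its conditional law given this path is the law of the vector of order statistics, in increasing order, of a sample of $k-1$ independent variables uniformly distributed on $[0,M_t^{(k)}]$. -/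

import Mathlib

open MeasureTheory ProbabilityTheory Set

/-- The positive quadrant `ℝ₊²`; a point `(t, x)` is the value `x` observed at time `t`. -/
def quadrant : Set (ℝ × ℝ) := Ici 0 ×ˢ Ici 0

/-- `P` is a Poisson point process in the positive quadrant with unit intensity, seen as a random
locally finite set of atoms: the number of atoms in a Borel set `B` of finite area has the Poisson
law with mean the area of `B`, and the numbers of atoms in disjoint Borel sets are independent. -/
structure IsUnitPoissonQuadrant {Ω : Type*} [MeasurableSpace Ω]
    (P : Ω → Set (ℝ × ℝ)) (μ : Measure Ω) : Prop where
  subset_quadrant : ∀ ω, P ω ⊆ quadrant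
  locallyFinite : ∀ ω, ∀ K : Set (ℝ × ℝ), IsCompact K → (P ω ∩ K).Finite
  measurable_count : ∀ B : Set (ℝ × ℝ), MeasurableSet B →
    Measurable fun ω => (P ω ∩ B).encard
  law_count : ∀ B : Set (ℝ × ℝ), MeasurableSet B → B ⊆ quadrant → volume B ≠ ⊤ →
    μ.map (fun ω => (P ω ∩ B).encard)
      = (poissonMeasure (volume B).toNNReal).map (fun n : ℕ => (n : ℕ∞))
  indep_count : ∀ (n : ℕ) (B : Fin n → Set (ℝ × ℝ)), (∀ i, MeasurableSet (B i)) →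
    (∀ i, B i ⊆ quadrant) → (∀ i j, i ≠ j → Disjoint (B i) (B j)) →
    iIndepFun (fun i ω => (P ω ∩ B i).encard) μ

/-- The `k`-th smallest value among the atoms of `S` observed in the time interval `[0, t]`. -/
noncomputable def kthMin (S : Set (ℝ × ℝ)) (k : ℕ) (t : ℝ) : ℝ :=
  sInf {x : ℝ | (k : ℕ∞) ≤ (S ∩ Icc 0 t ×ˢ Icc 0 x).encard}

/-- The atoms of `S` strictly south-west from `a`. -/
def southWest (S : Set (ℝ × ℝ)) (a : ℝ × ℝ) : Set (ℝ × ℝ) :=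
  {b ∈ S | b.1 < a.1 ∧ b.2 < a.2}

/-- The `j`-records of `S`: the atoms whose initial rank (one more than the number of atoms
strictly south-west) equals `j`. -/
def records (S : Set (ℝ × ℝ)) (j : ℕ) : Set (ℝ × ℝ) :=
  {a ∈ S | (southWest S a).encard + 1 = (j : ℕ∞)}

/-- The times in `[0, t]` at which `j`-records of `S` are observed. -/
def recordTimes (S : Set (ℝ × ℝ)) (j : ℕ) (t : ℝ) : Set ℝ :=
  Prod.fst '' records S j ∩ Icc 0 t

/-- The σ-algebra generated by the path `(M_s^(k), 0 < s ≤ t)` of the `k`-th minimum process. -/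
@[reducible] noncomputable def pathSigma {Ω : Type*} (P : Ω → Set (ℝ × ℝ)) (k : ℕ) (t : ℝ) : MeasurableSpace Ω :=
  ⨆ s ∈ Ioc (0 : ℝ) t, MeasurableSpace.comap (fun ω => kthMin (P ω) k s) inferInstance

/-- The σ-algebra generated by the random sets of `j`-record times in `[0, t]`, jointly for all
`j ≥ 1`, i.e. by the numbers of `j`-record times in Borel sets. -/
@[reducible] noncomputable def recordSigma {Ω : Type*} (P : Ω → Set (ℝ × ℝ)) (t : ℝ) : MeasurableSpace Ω :=
  ⨆ (j : ℕ) (_ : 1 ≤ j) (B : Set ℝ) (_ : MeasurableSet B),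
    MeasurableSpace.comap (fun ω => (recordTimes (P ω) j t ∩ B).encard) inferInstance

/-- The vector `(M_t^(1), …, M_t^(k-1))` of the `k - 1` smaller minima. -/
noncomputable def smallerMinima (S : Set (ℝ × ℝ)) (k : ℕ) (t : ℝ) : Fin (k - 1) → ℝ :=
  fun i => kthMin S (i + 1) t

/-- The order statistics of a sample `u`: its entries arranged in nondecreasing order. -/
noncomputable def orderStat {n : ℕ} (u : Fin n → ℝ) : Fin n → ℝ := u ∘ Tuple.sort u

theorem measurable_orderStat {n : ℕ} :
    Measurable (orderStat : (Fin n → ℝ) → (Fin n → ℝ)) := by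
  refine measurable_pi_lambda _ fun i => measurable_of_Iic fun c => ?_
  have h : (fun u : Fin n → ℝ => orderStat u i) ⁻¹' Iic c
      = {u | (i : ℕ) < ∑ j, if u j ≤ c then 1 else 0} := by
    ext u
    have h1 := Tuple.lt_card_le_iff_apply_le_of_monotone (f := orderStat u) (a := c)
      (j := i) (Tuple.monotone_sort u)
    have h2 : (∑ j, if u j ≤ c then 1 else 0) = ∑ j, if orderStat u j ≤ c then 1 else 0 :=
      (Equiv.sum_comp (Tuple.sort u) (fun j => if u j ≤ c then 1 else 0)).symm
    simp only [mem_preimage, mem_Iic, mem_ofPred_eq]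
    rw [h2, ← Finset.card_filter]
    exact h1.symm
  rw [h]
  refine measurableSet_lt measurable_const (Finset.measurable_sum _ fun j _ => ?_)
  exact Measurable.ite (measurableSet_le (measurable_pi_apply j) measurable_const)
    measurable_const measurable_const

/-- The law of the vector of order statistics of `n` independent variables that are uniformly
distributed on `[0, x]`. -/
noncomputable def uniformOrderStatLaw (n : ℕ) (x : ℝ) : Measure (Fin n → ℝ) :=
  (Measure.pi fun _ : Fin n => volume[|Icc 0 x]).map orderStat

/-- Conditional independence of `m₁` and `m₂` given the sub-σ-algebra `m'`, on an arbitrary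
probability space. -/
def CondIndepSigma {Ω : Type*} (m' m₁ m₂ : MeasurableSpace Ω) [MeasurableSpace Ω]
    (μ : Measure Ω) : Prop :=
  ∀ A F : Set Ω, MeasurableSet[m₁] A → MeasurableSet[m₂] F →
    μ⟦A ∩ F | m'⟧ =ᵐ[μ] μ⟦A | m'⟧ * μ⟦F | m'⟧

/-! Write m = k - 1 and fix a deterministic level c > 0. On the event that exactly m points lie in
[0,t] × [0,c), the Poisson property says that their heights are the order statistics of m uniform
variables on [0,c], independent of their times (listed in the order of the heights) and of all
points at height c or more; this is `measure_minVec_indep`.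

On that event the path of the k-th minimum and all record times are functions of those times and of
the upper points alone. Indeed an increasing change of heights below c alters neither: records only
compare heights, and k points cannot be collected below c. So the m heights may be replaced by the
fixed values c i / m (`recordTimes_respaced`, `kthMin_respaced`), and every event H of the path and
the records coincides on the event with one that does not involve the heights
(`exists_timeSigma_eq`).

The level wanted is the random M_t^(k). Require in addition a point with height in the dyadic
interval starting at c; this depends on upper points only and puts M_t^(k) in that interval, so c is
its dyadic rounding from below. Summing over the dyadic levels of mesh 2^(-n) and letting n tend to
infinity gives `measure_inter_minVec`, because the uniform order statistics on [0,x] are x times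
those on [0,1], hence depend on x weakly continuously.

The conditional law given path and records together is thus a function of M_t^(k), which belongs to
the path. Dropping the records from the condition leaves it unchanged, and this is conditional
independence (`condIndepSigma_of_condExp_sup`). -/

/-! ### Measurability of counts in random configurations -/

/-- A random locally finite set of points of the plane whose counts are measurable. -/
structure IsMeasurableConfig {Ω : Type*} [MeasurableSpace Ω] (Q : Ω → Set (ℝ × ℝ)) : Prop where
  locallyFinite : ∀ ω, ∀ K : Set (ℝ × ℝ), IsCompact K → (Q ω ∩ K).Finite
  measurable_count : ∀ B : Set (ℝ × ℝ), MeasurableSet B → Measurable fun ω => (Q ω ∩ B).encard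

namespace IsMeasurableConfig

variable {Ω : Type*} [MeasurableSpace Ω] {Q : Ω → Set (ℝ × ℝ)}

theorem finite_inter (hQ : IsMeasurableConfig Q) (ω : Ω) {B : Set (ℝ × ℝ)}
    (hB : Bornology.IsBounded B) : (Q ω ∩ B).Finite :=
  (hQ.locallyFinite ω _ hB.isCompact_closure).subset
    (inter_subset_inter_right _ subset_closure)

/-- The counting measure of a random configuration, as a kernel. -/
noncomputable def kernel (hQ : IsMeasurableConfig Q) : Kernel Ω (ℝ × ℝ) where
  toFun ω := Measure.count.restrict (Q ω)
  measurable' := by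
    refine Measure.measurable_of_measurable_coe _ fun B hB => ?_
    have : (fun ω => (Measure.count.restrict (Q ω)) B)
        = fun ω => (((Q ω ∩ B).encard : ℕ∞) : ENNReal) := by
      ext ω
      rw [Measure.restrict_apply hB, inter_comm]
      by_cases hf : (Q ω ∩ B).Finite
      · rw [Measure.count_apply hf.measurableSet]
      · rw [Measure.count_apply_infinite hf, Set.Infinite.encard_eq hf]
        rfl
    rw [this]
    exact (measurable_of_countable _).comp (hQ.measurable_count B hB)

theorem kernel_apply (hQ : IsMeasurableConfig Q) (ω : Ω) {B : Set (ℝ × ℝ)}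
    (hB : MeasurableSet B) : hQ.kernel ω B = (((Q ω ∩ B).encard : ℕ∞) : ENNReal) := by
  change (Measure.count.restrict (Q ω)) B = _
  rw [Measure.restrict_apply hB, inter_comm]
  by_cases hf : (Q ω ∩ B).Finite
  · rw [Measure.count_apply hf.measurableSet]
  · rw [Measure.count_apply_infinite hf, Set.Infinite.encard_eq hf]
    rfl

/-- The count in a bounded set is finite for each ω but not bounded in ω. Cutting Ω by the value r
of the count yields pieces of mass at most r. -/
theorem isSFiniteKernel_restrict (hQ : IsMeasurableConfig Q) {B : Set (ℝ × ℝ)}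
    (hB : MeasurableSet B) (hb : Bornology.IsBounded B) :
    IsSFiniteKernel (hQ.kernel.restrict hB) := by
  classical
  have hs : ∀ r : ℕ, MeasurableSet {ω | (Q ω ∩ B).encard = r} := fun r =>
    hQ.measurable_count B hB (measurableSet_singleton _)
  have hsum : hQ.kernel.restrict hB
      = Kernel.sum fun r : ℕ => Kernel.piecewise (hs r) (hQ.kernel.restrict hB) 0 := by
    ext ω C hC
    obtain ⟨r, hr⟩ : ∃ r : ℕ, (Q ω ∩ B).encard = r :=
      ⟨_, ((hQ.finite_inter ω hb).cast_ncard_eq).symm⟩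
    rw [Kernel.sum_apply' _ _ hC, tsum_eq_single r]
    · rw [Kernel.piecewise_apply, if_pos (show ω ∈ {ω | (Q ω ∩ B).encard = r} from hr)]
    · intro q hq
      rw [Kernel.piecewise_apply, if_neg]
      · simp
      · intro h
        exact hq (by exact_mod_cast (show (Q ω ∩ B).encard = q from h).symm.trans hr)
  rw [hsum]
  have : ∀ r : ℕ, IsFiniteKernel (Kernel.piecewise (hs r) (hQ.kernel.restrict hB) 0) := by
    intro r
    refine ⟨⟨r, by simp, fun ω => ?_⟩⟩
    rw [Kernel.piecewise_apply]
    split_ifs with h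
    · rw [Kernel.restrict_apply, Measure.restrict_apply_univ, hQ.kernel_apply ω hB,
        show (Q ω ∩ B).encard = r from h]
      simp
    · simp
  infer_instance

instance isSFiniteKernel (hQ : IsMeasurableConfig Q) : IsSFiniteKernel hQ.kernel := by
  set B : ℕ → Set (ℝ × ℝ) := disjointed fun n => Metric.closedBall 0 (n : ℝ) with hBdef
  have hB : ∀ n, MeasurableSet (B n) := fun n =>
    MeasurableSet.disjointed (fun n => measurableSet_closedBall) n
  have hb : ∀ n, Bornology.IsBounded (B n) := fun n =>
    Metric.isBounded_closedBall.subset (disjointed_subset _ n)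
  have hU : ⋃ n, B n = univ := by
    rw [hBdef, iUnion_disjointed]
    exact Metric.iUnion_closedBall_nat 0
  have hsum : hQ.kernel = Kernel.sum fun n => hQ.kernel.restrict (hB n) := by
    refine Kernel.ext fun ω => ?_
    rw [Kernel.sum_apply]
    simp only [Kernel.restrict_apply]
    rw [← Measure.restrict_iUnion (disjoint_disjointed _) hB, hU, Measure.restrict_univ]
  rw [hsum]
  have := fun n => hQ.isSFiniteKernel_restrict (hB n) (hb n)
  infer_instance

/-- The count is the kernel mass of a section, and s-finiteness makes such masses jointly
measurable. The extra parameter in `β` is needed for counts of points south-west of a moving atom.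
-/
theorem measurable_encard_section (hQ : IsMeasurableConfig Q) {β : Type*} [MeasurableSpace β]
    {S : Set ((Ω × β) × (ℝ × ℝ))} (hS : MeasurableSet S) :
    Measurable fun p : Ω × β => (Q p.1 ∩ {a | (p, a) ∈ S}).encard := by
  have h := Kernel.measurable_kernel_prodMk_left (κ := hQ.kernel.prodMkRight β) hS
  have h2 : Measurable fun p : Ω × β =>
      (((Q p.1 ∩ {a | (p, a) ∈ S}).encard : ℕ∞) : ENNReal) := by
    convert h using 2 with p
    rw [Kernel.prodMkRight_apply]
    exact (hQ.kernel_apply p.1 (measurable_prodMk_left hS)).symm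
  refine measurable_to_countable' fun n => ?_
  convert h2 (measurableSet_singleton (n : ENNReal)) using 1
  ext p
  simp

theorem measurable_encard_section' (hQ : IsMeasurableConfig Q)
    {S : Set (Ω × (ℝ × ℝ))} (hS : MeasurableSet S) :
    Measurable fun ω : Ω => (Q ω ∩ {a | (ω, a) ∈ S}).encard := by
  have h := hQ.measurable_encard_section (β := Unit)
    (S := {p | (p.1.1, p.2) ∈ S}) ((by fun_prop : Measurable
      fun p : (Ω × Unit) × (ℝ × ℝ) => (p.1.1, p.2)) hS)
  exact h.comp (measurable_id.prodMk measurable_const : Measurable fun ω : Ω => (ω, ()))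

theorem measurableSet_exists (hQ : IsMeasurableConfig Q)
    {S : Set (Ω × (ℝ × ℝ))} (hS : MeasurableSet S) :
    MeasurableSet {ω | ∃ a ∈ Q ω, (ω, a) ∈ S} := by
  have h := hQ.measurable_encard_section' hS (measurableSet_singleton 0).compl
  convert h using 1
  ext ω
  simp only [mem_ofPred_eq, mem_preimage, mem_compl_iff, mem_singleton_iff, encard_eq_zero,
    ← Ne.eq_def, ← nonempty_iff_ne_empty]
  rfl

end IsMeasurableConfig

/-- A set-valued map that hits Borel sets measurably has measurable counts. -/
theorem measurable_encard_of_hits {Ω α : Type*} [MeasurableSpace Ω] [TopologicalSpace α]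
    [T2Space α] [SecondCountableTopology α] [MeasurableSpace α] [OpensMeasurableSpace α]
    {T : Ω → Set α}
    (hT : ∀ C, MeasurableSet C → MeasurableSet {ω | (T ω ∩ C).Nonempty}) {B : Set α}
    (hB : MeasurableSet B) : Measurable fun ω => (T ω ∩ B).encard := by
  have key : ∀ r : ℕ, MeasurableSet {ω | (r : ℕ∞) ≤ (T ω ∩ B).encard} := by
    intro r
    -- In a Hausdorff space r distinct points are separated by disjoint basic open sets, and
    -- countably many choices of such sets suffice.
    have : {ω | (r : ℕ∞) ≤ (T ω ∩ B).encard} =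
        ⋃ f ∈ {f : Fin r → TopologicalSpace.countableBasis α |
          Pairwise fun i j => Disjoint (f i : Set α) (f j)},
          ⋂ i, {ω | (T ω ∩ (B ∩ f i)).Nonempty} := by
      ext ω
      simp only [mem_ofPred_eq, mem_iUnion, mem_iInter, exists_prop]
      constructor
      · intro h
        obtain ⟨F, hF, hFr⟩ := exists_subset_encard_eq h
        have hfin : F.Finite := finite_of_encard_eq_coe hFr
        obtain ⟨U, hU, hd⟩ := hfin.t2_separation
        have hcard : Nat.card F = r := by
          rw [Nat.card_coe_set_eq, ncard, hFr]; rfl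
        have := hfin.to_subtype
        let e : Fin r ≃ F := (Finite.equivFinOfCardEq hcard).symm
        have hb : ∀ i, ∃ V ∈ TopologicalSpace.countableBasis α, (e i : α) ∈ V ∧ V ⊆ U (e i) :=
          fun i => (TopologicalSpace.isBasis_countableBasis α).exists_subset_of_mem_open
            (hU (e i)).1 (hU (e i)).2
        choose V hV heV hVU using hb
        refine ⟨fun i => ⟨V i, hV i⟩, fun i j hij => ?_, fun i => ⟨e i, (hF (e i).2).1,
          (hF (e i).2).2, heV i⟩⟩
        exact (hd (e i).2 (e j).2 fun h => hij (e.injective (Subtype.ext h))).mono (hVU i) (hVU j)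
      · rintro ⟨f, hf, hne⟩
        choose x hx using hne
        have hinj : Function.Injective x := fun i j hij => by
          by_contra hne
          exact (disjoint_left.1 (hf hne)) (hx i).2.2 (hij ▸ (hx j).2.2)
        calc (r : ℕ∞) = (range x).encard := by
              rw [← image_univ, hinj.encard_image, encard_univ]
              simp
          _ ≤ _ := by
            refine encard_le_encard (range_subset_iff.2 fun i => ?_)
            exact ⟨(hx i).1, (hx i).2.1⟩
    rw [this]
    refine MeasurableSet.biUnion (to_countable _) fun f _ => MeasurableSet.iInter fun i =>
      hT _ (hB.inter ?_)
    exact ((TopologicalSpace.isBasis_countableBasis α).isOpen (f i).2).measurableSet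
  refine measurable_to_countable' fun n => ?_
  induction n using ENat.recTopCoe with
  | top =>
    have : (fun ω => (T ω ∩ B).encard) ⁻¹' {⊤} = ⋂ r : ℕ, {ω | (r : ℕ∞) ≤ (T ω ∩ B).encard} := by
      ext ω
      simp only [mem_preimage, mem_singleton_iff, mem_iInter, mem_ofPred_eq]
      exact ⟨fun h r => h ▸ le_top, fun h => ENat.eq_top_iff_forall_ge.2 h⟩
    rw [this]
    exact MeasurableSet.iInter key
  | coe n =>
    have : (fun ω => (T ω ∩ B).encard) ⁻¹' {(n : ℕ∞)} = {ω | (n : ℕ∞) ≤ (T ω ∩ B).encard}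
        \ {ω | ((n + 1 : ℕ) : ℕ∞) ≤ (T ω ∩ B).encard} := by
      ext ω
      simp only [mem_preimage, mem_singleton_iff, mem_sdiff, mem_ofPred_eq]
      rw [Nat.cast_add, Nat.cast_one, not_le, Order.lt_add_one_iff_of_not_isMax (by simp)]
      exact ⟨fun h => ⟨h.ge, h.le⟩, fun h => le_antisymm h.2 h.1⟩
    rw [this]
    exact (key n).diff (key (n + 1))

/-! ### The k-th minimum and its measurability -/

/-- The set of levels at which `k` values have been observed by time `t`. -/
def countLevels (S : Set (ℝ × ℝ)) (k : ℕ) (t : ℝ) : Set ℝ :=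
  {x : ℝ | (k : ℕ∞) ≤ (S ∩ Icc 0 t ×ˢ Icc 0 x).encard}

theorem kthMin_eq_sInf (S : Set (ℝ × ℝ)) (k : ℕ) (t : ℝ) :
    kthMin S k t = sInf (countLevels S k t) := rfl

theorem countLevels_upward {S : Set (ℝ × ℝ)} {k : ℕ} {t x y : ℝ} (h : x ∈ countLevels S k t)
    (hxy : x ≤ y) : y ∈ countLevels S k t :=
  le_trans h (encard_le_encard (inter_subset_inter_right _
    (prod_mono_right (Icc_subset_Icc_right hxy))))

theorem countLevels_nonneg {S : Set (ℝ × ℝ)} {k : ℕ} (hk : 1 ≤ k) {t x : ℝ}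
    (h : x ∈ countLevels S k t) : 0 ≤ x := by
  by_contra hx
  have : (S ∩ Icc 0 t ×ˢ Icc 0 x) = ∅ := by
    rw [Icc_eq_empty hx]; simp
  simp only [countLevels, mem_ofPred_eq, this, encard_empty, nonpos_iff_eq_zero,
    Nat.cast_eq_zero] at h
  omega

theorem isCompact_Icc_prod (a b c d : ℝ) : IsCompact (Icc a b ×ˢ Icc c d) :=
  isCompact_Icc.prod isCompact_Icc

/-- If there are at least `k` values by time `t`, the `k`-th minimum is one of them. -/
theorem kthMin_attained {S : Set (ℝ × ℝ)} (hS : ∀ K, IsCompact K → (S ∩ K).Finite) {k : ℕ}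
    (hk : 1 ≤ k) {t x : ℝ} (hx : x ∈ countLevels S k t) :
    kthMin S k t ∈ countLevels S k t ∧
      ∃ a ∈ S, a.1 ∈ Icc 0 t ∧ a.2 = kthMin S k t ∧ 0 ≤ a.2 := by
  have hfin : (S ∩ Icc 0 t ×ˢ Icc 0 x).Finite := hS _ (isCompact_Icc_prod ..)
  -- Only finitely many observed heights matter: lowering a level to the largest observed height
  -- below it loses no point, so the infimum is the minimum of a finite set.
  set V : Set ℝ := {y ∈ Prod.snd '' (S ∩ Icc 0 t ×ˢ Icc 0 x) | y ∈ countLevels S k t} with hV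
  have hVfin : V.Finite := (hfin.image _).subset fun y hy => hy.1
  have hdown : ∀ y ∈ countLevels S k t, y ≤ x → ∃ v ∈ V, v ≤ y := by
    intro y hy hyx
    have hne : (S ∩ Icc 0 t ×ˢ Icc 0 y).Nonempty := by
      rw [← encard_pos]
      exact lt_of_lt_of_le (by exact_mod_cast hk) hy
    obtain ⟨a, ha, hmax⟩ := Set.exists_max_image _ Prod.snd
      (hS _ (isCompact_Icc_prod 0 t 0 y)) hne
    have hay : a.2 ≤ y := ha.2.2.2
    refine ⟨a.2, ⟨⟨a, ⟨ha.1, ha.2.1, ha.2.2.1, hay.trans hyx⟩, rfl⟩, ?_⟩, hay⟩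
    refine le_trans hy (encard_le_encard fun b hb => ?_)
    exact ⟨hb.1, hb.2.1, hb.2.2.1, hmax b hb⟩
  obtain ⟨v0, hv0, -⟩ := hdown x hx le_rfl
  obtain ⟨v, hv, hmin⟩ := Set.exists_min_image V id hVfin ⟨v0, hv0⟩
  have hleast : IsLeast (countLevels S k t) v := by
    refine ⟨hv.2, fun y hy => ?_⟩
    rcases le_total y x with hyx | hyx
    · obtain ⟨w, hw, hwy⟩ := hdown y hy hyx
      exact (hmin w hw).trans hwy
    · obtain ⟨a, ha, rfl⟩ := hv.1
      exact (show a.2 ≤ x from ha.2.2.2).trans hyx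
  have hveq : kthMin S k t = v := hleast.csInf_eq
  obtain ⟨a, ha, hav⟩ := hv.1
  rw [hveq]
  exact ⟨hv.2, a, ha.1, ha.2.1, hav, ha.2.2.1⟩

/-- Some level must be reached, as otherwise the infimum is that of the empty set, with default
value 0. -/
theorem kthMin_le_iff {S : Set (ℝ × ℝ)} (hS : ∀ K, IsCompact K → (S ∩ K).Finite) {k : ℕ}
    (hk : 1 ≤ k) {t x : ℝ} (hx : x ∈ countLevels S k t) (y : ℝ) :
    kthMin S k t ≤ y ↔ y ∈ countLevels S k t :=
  ⟨countLevels_upward (kthMin_attained hS hk hx).1,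
    fun h => csInf_le ⟨0, fun _ hz => countLevels_nonneg hk hz⟩ h⟩

namespace IsMeasurableConfig

variable {Ω : Type*} [MeasurableSpace Ω] {Q : Ω → Set (ℝ × ℝ)}

theorem measurableSet_mem_countLevels (hQ : IsMeasurableConfig Q) (k : ℕ) (t x : ℝ) :
    MeasurableSet {ω | x ∈ countLevels (Q ω) k t} :=
  hQ.measurable_count _ (measurableSet_Icc.prod measurableSet_Icc)
    (MeasurableSet.of_discrete (s := {n : ℕ∞ | (k : ℕ∞) ≤ n}))

theorem measurable_kthMin (hQ : IsMeasurableConfig Q) {k : ℕ} (hk : 1 ≤ k) (t : ℝ) :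
    Measurable fun ω => kthMin (Q ω) k t := by
  refine measurable_of_Iic fun y => ?_
  -- The second set collects the ω for which no level is reached (integer levels suffice to test
  -- this); there the k-th minimum is 0 by default.
  have : (fun ω => kthMin (Q ω) k t) ⁻¹' Iic y = {ω | y ∈ countLevels (Q ω) k t} ∪
      ((⋂ n : ℕ, {ω | (n : ℝ) ∈ countLevels (Q ω) k t}ᶜ) ∩ {_ω | 0 ≤ y}) := by
    ext ω
    simp only [mem_preimage, mem_Iic, mem_union, mem_ofPred_eq, mem_inter_iff, mem_iInter,
      mem_compl_iff]
    by_cases hne : ∃ x, x ∈ countLevels (Q ω) k t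
    · obtain ⟨x, hx⟩ := hne
      rw [kthMin_le_iff (hQ.locallyFinite ω) hk hx]
      refine ⟨Or.inl, fun h => h.resolve_right fun h' => ?_⟩
      obtain ⟨n, hn⟩ := exists_nat_ge x
      exact h'.1 n (countLevels_upward hx hn)
    · have hemp : countLevels (Q ω) k t = ∅ := by
        ext x; simpa using fun h => hne ⟨x, h⟩
      simp [kthMin_eq_sInf, hemp]
  rw [this]
  exact (hQ.measurableSet_mem_countLevels k t y).union
    ((MeasurableSet.iInter fun n : ℕ => (hQ.measurableSet_mem_countLevels k t n).compl).inter
      (MeasurableSet.const (0 ≤ y)))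

/-- Two atoms may share a time, so times of records cannot be counted by counting records. Hitting a
Borel set C, however, just asks for an atom of rank j with time in C, and hits determine counts. -/
theorem measurable_encard_recordTimes (hQ : IsMeasurableConfig Q) (j : ℕ) (t : ℝ) {B : Set ℝ}
    (hB : MeasurableSet B) : Measurable fun ω => (recordTimes (Q ω) j t ∩ B).encard := by
  refine measurable_encard_of_hits (fun C hC => ?_) hB
  have h0 : MeasurableSet {q : (Ω × (ℝ × ℝ)) × (ℝ × ℝ) | q.2.1 < q.1.2.1 ∧ q.2.2 < q.1.2.2} :=
    MeasurableSet.inter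
      (measurableSet_lt (f := fun q : (Ω × (ℝ × ℝ)) × (ℝ × ℝ) => q.2.1)
        (g := fun q => q.1.2.1) (by fun_prop) (by fun_prop))
      (measurableSet_lt (f := fun q : (Ω × (ℝ × ℝ)) × (ℝ × ℝ) => q.2.2)
        (g := fun q => q.1.2.2) (by fun_prop) (by fun_prop))
  have h1 : Measurable fun p : Ω × (ℝ × ℝ) => (southWest (Q p.1) p.2).encard :=
    hQ.measurable_encard_section h0
  have h2 : MeasurableSet {p : Ω × (ℝ × ℝ) | (southWest (Q p.1) p.2).encard + 1 = (j : ℕ∞)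
      ∧ p.2.1 ∈ Icc 0 t ∩ C} := by
    refine MeasurableSet.inter ?_ ((by fun_prop : Measurable fun p : Ω × (ℝ × ℝ) => p.2.1)
      (measurableSet_Icc.inter hC))
    exact h1 (MeasurableSet.of_discrete (s := {n : ℕ∞ | n + 1 = j}))
  convert hQ.measurableSet_exists h2 using 1
  ext ω
  simp only [recordTimes, records, Set.Nonempty, mem_inter_iff, mem_image, mem_ofPred_eq]
  constructor
  · rintro ⟨s, ⟨⟨a, ⟨ha, haj⟩, rfl⟩, hs⟩, hC⟩
    exact ⟨a, ha, haj, hs, hC⟩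
  · rintro ⟨a, ha, haj, hs, hC⟩
    exact ⟨a.1, ⟨⟨a, ⟨ha, haj⟩, rfl⟩, hs⟩, hC⟩

end IsMeasurableConfig

/-! ### Order statistics of uniform samples -/

/-- The open chamber of strictly increasing vectors. -/
def chamber (n : ℕ) : Set (Fin n → ℝ) := {u | StrictMono u}

theorem isOpen_chamber (n : ℕ) : IsOpen (chamber n) := by
  have : chamber n = ⋂ i, ⋂ j, ⋂ _ : i < j, {u | u i < u j} := by
    ext u; simp [chamber, StrictMono]
  rw [this]
  refine isOpen_iInter_of_finite fun i => isOpen_iInter_of_finite fun j =>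
    isOpen_iInter_of_finite fun _ => isOpen_lt (continuous_apply i) (continuous_apply j)

theorem measurableSet_chamber (n : ℕ) : MeasurableSet (chamber n) :=
  (isOpen_chamber n).measurableSet

/-- Finite measures that agree on the boxes inside the chamber agree on the chamber. -/
theorem restrict_chamber_ext {n : ℕ} {ν₁ ν₂ : Measure (Fin n → ℝ)} [IsFiniteMeasure ν₁]
    (h : ∀ J : Fin n → Set ℝ, (∀ i, MeasurableSet (J i)) → univ.pi J ⊆ chamber n →
      ν₁ (univ.pi J) = ν₂ (univ.pi J)) :
    ν₁.restrict (chamber n) = ν₂.restrict (chamber n) := by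
  -- The chamber is open, hence a countable union of sup-norm balls. These are boxes, and inside
  -- each of them the boxes form a generating π-system.
  have hball : ∀ u ∈ chamber n, ∃ ε > 0, Metric.ball u ε ⊆ chamber n :=
    Metric.isOpen_iff.1 (isOpen_chamber n)
  choose! ε hε hsub using hball
  obtain ⟨D, hD, hDc, hcov⟩ := TopologicalSpace.countable_cover_nhdsWithin
    (f := fun u => Metric.ball u (ε u)) (s := chamber n)
    fun u hu => mem_nhdsWithin_of_mem_nhds (Metric.ball_mem_nhds u (hε u hu))
  have heq : chamber n = ⋃ u ∈ D, Metric.ball u (ε u) :=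
    Subset.antisymm hcov (iUnion₂_subset fun u hu => hsub u (hD hu))
  rw [heq, Measure.restrict_biUnion_congr hDc]
  intro u hu
  have hb : Metric.ball u (ε u) = univ.pi fun i => Metric.ball (u i) (ε u) :=
    (ball_pi u (hε u (hD hu)))
  have hs := hsub u (hD hu)
  rw [hb] at hs ⊢
  have hm : MeasurableSet (univ.pi fun i => Metric.ball (u i) (ε u)) :=
    MeasurableSet.univ_pi fun i => measurableSet_ball
  refine ext_of_generate_finite _ generateFrom_pi.symm isPiSystem_pi ?_ ?_
  · rintro _ ⟨J, hJ, rfl⟩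
    have hJ' : ∀ i, MeasurableSet (J i) := fun i => hJ i (mem_univ i)
    have hJm : MeasurableSet (univ.pi J) := MeasurableSet.univ_pi hJ'
    rw [Measure.restrict_apply hJm, Measure.restrict_apply hJm, ← pi_inter_distrib]
    refine h _ (fun i => (hJ' i).inter measurableSet_ball) ?_
    rw [pi_inter_distrib]
    exact inter_subset_right.trans hs
  · rw [Measure.restrict_apply_univ, Measure.restrict_apply_univ]
    exact h _ (fun i => measurableSet_ball) hs

instance (x : ℝ) : NullSingletonClass (volume[|Icc 0 x]) where
  measure_singleton y := by
    rw [cond_apply measurableSet_Icc,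
      measure_mono_null (inter_subset_right) (Real.volume_singleton (a := y)), mul_zero]

theorem isProbabilityMeasure_cond_Icc {x : ℝ} (hx : 0 < x) :
    IsProbabilityMeasure (volume[|Icc 0 x]) :=
  cond_isProbabilityMeasure_of_finite (by simp [hx]) (by simp)

theorem isProbabilityMeasure_uniformOrderStatLaw (n : ℕ) {x : ℝ} (hx : 0 < x) :
    IsProbabilityMeasure (uniformOrderStatLaw n x) := by
  have := isProbabilityMeasure_cond_Icc hx
  exact Measure.isProbabilityMeasure_map measurable_orderStat.aemeasurable

theorem orderStat_eq_comp {n : ℕ} {u : Fin n → ℝ} {σ : Equiv.Perm (Fin n)}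
    (h : Monotone (u ∘ σ)) : orderStat u = u ∘ σ :=
  (Tuple.comp_sort_eq_comp_iff_monotone.2 h).symm

/-- Vectors of a box inside the chamber are sorted, so any rearrangement of `u` that lands in the
box is the sorted one. -/
theorem orderStat_mem_box_iff {n : ℕ} {J : Fin n → Set ℝ} (hJ : univ.pi J ⊆ chamber n)
    (u : Fin n → ℝ) :
    orderStat u ∈ univ.pi J ↔ ∃ σ : Equiv.Perm (Fin n), u ∘ σ ∈ univ.pi J := by
  refine ⟨fun h => ⟨Tuple.sort u, h⟩, fun ⟨σ, hσ⟩ => ?_⟩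
  rw [orderStat_eq_comp (hJ hσ).monotone]
  exact hσ

theorem pi_perm_box {n : ℕ} (ν : Measure ℝ) [SigmaFinite ν] (J : Fin n → Set ℝ)
    (σ : Equiv.Perm (Fin n)) :
    (Measure.pi fun _ : Fin n => ν) {u | u ∘ σ ∈ univ.pi J} = ∏ i, ν (J i) := by
  have : {u : Fin n → ℝ | u ∘ σ ∈ univ.pi J} = univ.pi fun i => J (σ.symm i) := by
    ext u
    simp only [mem_ofPred_eq, mem_univ_pi, Function.comp]
    exact ⟨fun h i => by simpa using h (σ.symm i), fun h i => by simpa using h (σ i)⟩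
  rw [this, Measure.pi_pi]
  exact Equiv.prod_comp σ.symm fun i => ν (J i)

/-- The preimage of the box under sorting is the union of its n! permuted copies. They have equal
mass, and are disjoint since a vector with distinct entries has only one sorting permutation. -/
theorem uniformOrderStatLaw_box {n : ℕ} {x : ℝ} (hx : 0 < x) {J : Fin n → Set ℝ}
    (hJm : ∀ i, MeasurableSet (J i)) (hJ : univ.pi J ⊆ chamber n) :
    uniformOrderStatLaw n x (univ.pi J) = n.factorial * ∏ i, volume[|Icc 0 x] (J i) := by
  have := isProbabilityMeasure_cond_Icc hx
  have hm : MeasurableSet (univ.pi J) := MeasurableSet.univ_pi hJm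
  rw [uniformOrderStatLaw, Measure.map_apply measurable_orderStat hm]
  have : orderStat ⁻¹' univ.pi J
      = ⋃ σ : Equiv.Perm (Fin n), {u : Fin n → ℝ | u ∘ σ ∈ univ.pi J} := by
    ext u
    rw [mem_preimage, orderStat_mem_box_iff hJ, mem_iUnion]
    rfl
  rw [this, measure_iUnion]
  · simp only [pi_perm_box, tsum_fintype, Finset.sum_const, nsmul_eq_mul, Finset.card_univ,
      Fintype.card_perm, Fintype.card_fin]
  · intro σ τ hστ
    refine disjoint_left.2 fun u hσ hτ => hστ ?_
    have h1 := orderStat_eq_comp (hJ hσ).monotone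
    have h2 := orderStat_eq_comp (hJ hτ).monotone
    have hinj : Function.Injective u := by
      have := (hJ hσ).injective
      exact (Equiv.injective_comp σ u).1 this
    ext i
    have := congrFun (h1.symm.trans h2) i
    rw [hinj this]
  · intro σ
    exact (measurable_pi_lambda (fun u : Fin n → ℝ => u ∘ σ)
      fun i => measurable_pi_apply (σ i)) hm

theorem pi_eq_coord_null {n : ℕ} (ν : Measure ℝ) [IsProbabilityMeasure ν] [NullSingletonClass ν]
    {i j : Fin n} (hij : i ≠ j) : (Measure.pi fun _ : Fin n => ν) {u | u i = u j} = 0 := by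
  have hind : IndepFun (fun u : Fin n → ℝ => u i) (fun u => u j)
      (Measure.pi fun _ : Fin n => ν) :=
    (iIndepFun_pi (μ := fun _ : Fin n => ν) (X := fun _ x => x)
      fun _ => aemeasurable_id).indepFun hij
  have hmap := (indepFun_iff_map_prod_eq_prod_map_map (measurable_pi_apply i).aemeasurable
    (measurable_pi_apply j).aemeasurable).1 hind
  have hd : MeasurableSet {p : ℝ × ℝ | p.1 = p.2} :=
    measurableSet_eq_fun measurable_fst measurable_snd
  have h1 : (Measure.pi fun _ : Fin n => ν) {u | u i = u j}
      = ((Measure.pi fun _ : Fin n => ν).map fun u => (u i, u j)) {p : ℝ × ℝ | p.1 = p.2} := by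
    rw [Measure.map_apply (by fun_prop) hd]
    rfl
  rw [h1, hmap, (measurePreserving_eval (fun _ : Fin n => ν) i).map_eq,
    (measurePreserving_eval (fun _ : Fin n => ν) j).map_eq, Measure.measure_prod_null hd]
  refine Filter.Eventually.of_forall fun y => ?_
  have : Prod.mk y ⁻¹' {p : ℝ × ℝ | p.1 = p.2} = {y} := by
    ext z; simp [eq_comm]
  simp [this]

/-- A sorted vector outside the chamber has two equal entries, and ties between independent atomless
variables are null. -/
theorem uniformOrderStatLaw_chamber_compl (n : ℕ) {x : ℝ} (hx : 0 < x) :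
    uniformOrderStatLaw n x (chamber n)ᶜ = 0 := by
  have := isProbabilityMeasure_cond_Icc hx
  rw [uniformOrderStatLaw, Measure.map_apply measurable_orderStat
    (measurableSet_chamber n).compl]
  refine measure_mono_null (t := ⋃ i : Fin n, ⋃ j : Fin n, ⋃ _ : i ≠ j, {u | u i = u j}) ?_ ?_
  · intro u hu
    by_contra hcon
    apply hu
    have hinj : Function.Injective u := by
      intro i j hij
      by_contra hne
      exact hcon (mem_iUnion.2 ⟨i, mem_iUnion.2 ⟨j, mem_iUnion.2 ⟨hne, hij⟩⟩⟩)
    exact (Tuple.monotone_sort u).strictMono_of_injective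
      (hinj.comp (Tuple.sort u).injective)
  · simp only [measure_iUnion_null_iff]
    exact fun i j hij => pi_eq_coord_null _ hij

theorem map_mul_cond_Icc {x : ℝ} (hx : 0 < x) :
    (volume[|Icc (0 : ℝ) 1]).map (fun y => x * y) = volume[|Icc 0 x] := by
  ext B hB
  rw [Measure.map_apply (by fun_prop) hB, cond_apply measurableSet_Icc,
    cond_apply measurableSet_Icc]
  have : Icc (0 : ℝ) 1 ∩ (fun y => x * y) ⁻¹' B = (fun y => x * y) ⁻¹' (Icc 0 x ∩ B) := by
    ext y
    simp only [mem_inter_iff, mem_Icc, mem_preimage]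
    constructor
    · rintro ⟨⟨h0, h1⟩, h2⟩
      exact ⟨⟨by positivity, by nlinarith⟩, h2⟩
    · rintro ⟨⟨h0, h1⟩, h2⟩
      exact ⟨⟨nonneg_of_mul_nonneg_right h0 hx, by nlinarith⟩, h2⟩
  rw [this, Real.volume_preimage_mul_left hx.ne']
  simp only [Real.volume_Icc, sub_zero, ENNReal.ofReal_one, inv_one, one_mul]
  rw [abs_of_pos (inv_pos.2 hx), ENNReal.ofReal_inv_of_pos hx]

theorem orderStat_smul {n : ℕ} {x : ℝ} (hx : 0 ≤ x) (u : Fin n → ℝ) :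
    orderStat (x • u) = x • orderStat u := by
  have h : Monotone ((x • u) ∘ Tuple.sort u) := fun i j hij =>
    mul_le_mul_of_nonneg_left (Tuple.monotone_sort u hij) hx
  rw [orderStat_eq_comp h]
  rfl

/-- Expressing all laws through the one on [0,1] gives measurability and continuity in `x`.
Positivity is needed because conditioning on a null interval gives the zero measure. -/
theorem uniformOrderStatLaw_eq_map (n : ℕ) {x : ℝ} (hx : 0 < x) :
    uniformOrderStatLaw n x = (uniformOrderStatLaw n 1).map (x • ·) := by
  have := isProbabilityMeasure_cond_Icc (x := 1) one_pos
  have h1 : (Measure.pi fun _ : Fin n => volume[|Icc (0 : ℝ) x])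
      = (Measure.pi fun _ : Fin n => volume[|Icc (0 : ℝ) 1]).map (x • ·) := by
    have h := Measure.pi_map_pi (μ := fun _ : Fin n => volume[|Icc (0 : ℝ) 1])
      (f := fun _ y => x * y) fun _ => by fun_prop
    rw [← map_mul_cond_Icc hx, ← h]
    rfl
  rw [uniformOrderStatLaw, uniformOrderStatLaw, h1, Measure.map_map measurable_orderStat
    (measurable_const_smul x), Measure.map_map (measurable_const_smul x) measurable_orderStat]
  congr 1
  ext u
  exact congrFun (orderStat_smul hx.le u) _

/-! ### Enumerating the points below a level -/

/-- The points observed by time `t` with value in `[0, c)`. -/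
def lowerStrip (t c : ℝ) : Set (ℝ × ℝ) := Icc 0 t ×ˢ Ico 0 c

/-- The points observed by time `t` with value in `[c, ∞)`. -/
def upperStrip (t c : ℝ) : Set (ℝ × ℝ) := Icc 0 t ×ˢ Ici c

theorem measurableSet_lowerStrip (t c : ℝ) : MeasurableSet (lowerStrip t c) :=
  measurableSet_Icc.prod measurableSet_Ico

theorem measurableSet_upperStrip (t c : ℝ) : MeasurableSet (upperStrip t c) :=
  measurableSet_Icc.prod measurableSet_Ici

theorem lowerStrip_finite {S : Set (ℝ × ℝ)} (hS : ∀ K, IsCompact K → (S ∩ K).Finite) (t c : ℝ) :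
    (S ∩ lowerStrip t c).Finite :=
  (hS _ (isCompact_Icc_prod 0 t 0 c)).subset
    (inter_subset_inter_right _ (prod_mono_right Ico_subset_Icc_self))

/-- The vector of the `n` smallest values observed by time `t`. -/
noncomputable def minVec (S : Set (ℝ × ℝ)) (n : ℕ) (t : ℝ) : Fin n → ℝ :=
  fun i => kthMin S (i + 1) t

/-- The time at which the `k`-th smallest value by time `t` was observed. -/
noncomputable def kthTime (S : Set (ℝ × ℝ)) (k : ℕ) (t : ℝ) : ℝ :=
  sInf {s | (s, kthMin S k t) ∈ S ∧ s ∈ Icc 0 t}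

/-- The times of the `n` smallest values observed by time `t`, in the order of the values. -/
noncomputable def timeVec (S : Set (ℝ × ℝ)) (n : ℕ) (t : ℝ) : Fin n → ℝ :=
  fun i => kthTime S (i + 1) t

theorem exists_enum {S : Set (ℝ × ℝ)} {t c : ℝ} {m : ℕ} (h : (S ∩ lowerStrip t c).encard = m) :
    ∃ b : Fin m → ℝ × ℝ, Function.Injective b ∧ range b = S ∩ lowerStrip t c ∧
      Monotone fun i => (b i).2 := by
  have hfin : (S ∩ lowerStrip t c).Finite := finite_of_encard_eq_coe h
  have hcard : Nat.card ↥(S ∩ lowerStrip t c) = m := by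
    rw [Nat.card_coe_set_eq, ncard, h]; rfl
  have := hfin.to_subtype
  let e : Fin m ≃ ↥(S ∩ lowerStrip t c) := (Finite.equivFinOfCardEq hcard).symm
  let f : Fin m → ℝ := fun i => (e i : ℝ × ℝ).2
  refine ⟨fun i => e (Tuple.sort f i), ?_, ?_, Tuple.monotone_sort f⟩
  · exact Subtype.val_injective.comp (e.injective.comp (Tuple.sort f).injective)
  · ext a
    constructor
    · rintro ⟨i, rfl⟩
      exact (e _).2
    · intro ha
      exact ⟨(Tuple.sort f).symm (e.symm ⟨a, ha⟩), by simp⟩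

/-- With indices from 0, the points up to index i are i + 1 in number and reach height at most that
of `b i`; at any smaller level only the i points before it can be present. -/
theorem minVec_eq_of_enum {S : Set (ℝ × ℝ)} {t c : ℝ} {m : ℕ} {b : Fin m → ℝ × ℝ}
    (hb : Function.Injective b) (hr : range b = S ∩ lowerStrip t c)
    (hm : Monotone fun i => (b i).2) (i : Fin m) : minVec S m t i = (b i).2 := by
  have hbm : ∀ j, b j ∈ S ∩ lowerStrip t c := fun j => hr ▸ mem_range_self j
  have hl : IsLeast (countLevels S (i + 1) t) (b i).2 := by
    constructor
    · have h1 : (b '' Iic i).encard = ((i + 1 : ℕ) : ℕ∞) := by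
        rw [hb.encard_image, ← Finset.coe_Iic, encard_coe_eq_coe_finsetCard, Fin.card_Iic]
      refine h1.symm.le.trans (encard_le_encard ?_)
      rintro _ ⟨j, hj, rfl⟩
      exact ⟨(hbm j).1, (hbm j).2.1, (hbm j).2.2.1, hm hj⟩
    · intro y hy
      by_contra hlt
      have h1 : (b '' Iio i).encard = ((i : ℕ) : ℕ∞) := by
        rw [hb.encard_image, ← Finset.coe_Iio, encard_coe_eq_coe_finsetCard, Fin.card_Iio]
      have h2 : S ∩ Icc 0 t ×ˢ Icc 0 y ⊆ b '' Iio i := by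
        intro a ha
        have hay : a.2 ≤ y := ha.2.2.2
        have hai : a.2 < (b i).2 := lt_of_le_of_lt hay (not_le.1 hlt)
        have : a ∈ range b := by
          rw [hr]
          exact ⟨ha.1, ha.2.1, ha.2.2.1, hai.trans (hbm i).2.2.2⟩
        obtain ⟨j, rfl⟩ := this
        refine ⟨j, ?_, rfl⟩
        by_contra hji
        exact absurd (hm (not_lt.1 hji)) (not_le.2 hai)
      have h3 : ((i + 1 : ℕ) : ℕ∞) ≤ ((i : ℕ) : ℕ∞) :=
        le_trans hy ((encard_le_encard h2).trans h1.le)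
      have : (i : ℕ) + 1 ≤ i := by exact_mod_cast h3
      omega
  exact hl.csInf_eq

/-- Strict monotonicity leaves a single time at the height of `b i`, so the infimum defining
`kthTime` is over a singleton. With ties it could pick another point's time. -/
theorem timeVec_eq_of_enum {S : Set (ℝ × ℝ)} {t c : ℝ} {m : ℕ} {b : Fin m → ℝ × ℝ}
    (hr : range b = S ∩ lowerStrip t c) (hm : StrictMono fun i => (b i).2) (i : Fin m) :
    timeVec S m t i = (b i).1 := by
  have hb : Function.Injective b := fun i j h => hm.injective (congrArg Prod.snd h)
  have hbm : ∀ j, b j ∈ S ∩ lowerStrip t c := fun j => hr ▸ mem_range_self j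
  have hX : kthMin S (i + 1) t = (b i).2 := minVec_eq_of_enum hb hr hm.monotone i
  have : {s | (s, kthMin S (i + 1) t) ∈ S ∧ s ∈ Icc 0 t} = {(b i).1} := by
    rw [hX]
    ext s
    rw [mem_ofPred_eq, mem_singleton_iff]
    constructor
    · rintro ⟨hs, hst⟩
      have : (s, (b i).2) ∈ range b := by
        rw [hr]
        exact ⟨hs, hst, (hbm i).2.2⟩
      obtain ⟨j, hj⟩ := this
      have : j = i := hm.injective (by simp [hj])
      rw [← this, hj]
    · rintro rfl
      exact ⟨(hbm i).1, (hbm i).2.1⟩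
  rw [timeVec, kthTime, this, csInf_singleton]

/-- Changing two coordinates of a point of the box stays in the box. Nonemptiness supplies the other
coordinates. -/
theorem box_lt {n : ℕ} {J : Fin n → Set ℝ} (hJ : univ.pi J ⊆ chamber n)
    (hne : (univ.pi J).Nonempty) {i j : Fin n} (hij : i < j) {x y : ℝ} (hx : x ∈ J i)
    (hy : y ∈ J j) : x < y := by
  obtain ⟨u, hu⟩ := hne
  have h : Function.update (Function.update u i x) j y ∈ univ.pi J := by
    intro l _
    by_cases hl : l = j
    · subst hl; simpa using hy
    · rw [Function.update_of_ne hl]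
      by_cases hl' : l = i
      · subst hl'; simpa using hx
      · rw [Function.update_of_ne hl']
        exact hu l (mem_univ l)
  have := hJ h hij
  rwa [Function.update_self, Function.update_of_ne hij.ne, Function.update_self] at this

/-- The event that the `m` lowest points lie in prescribed boxes, in terms of counts. -/
theorem mem_boxes_iff {S : Set (ℝ × ℝ)} {t c : ℝ} {m : ℕ} {I J : Fin m → Set ℝ}
    (hI : ∀ i, I i ⊆ Icc 0 t) (hJ : ∀ i, J i ⊆ Ico 0 c)
    (hlt : ∀ i j, i < j → ∀ x ∈ J i, ∀ y ∈ J j, x < y) :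
    ((S ∩ lowerStrip t c).encard = m ∧ minVec S m t ∈ univ.pi J ∧ timeVec S m t ∈ univ.pi I) ↔
      (∀ i, (S ∩ I i ×ˢ J i).encard = 1) ∧
        (S ∩ (lowerStrip t c \ ⋃ i, I i ×ˢ J i)).encard = 0 := by
  constructor
  · rintro ⟨hN, hX, hT⟩
    obtain ⟨b, hb, hr, hm⟩ := exists_enum hN
    have hXb := minVec_eq_of_enum hb hr hm
    have hbJ : ∀ i, (b i).2 ∈ J i := fun i => hXb i ▸ hX i (mem_univ i)
    have hs : StrictMono fun i => (b i).2 := fun i j hij => hlt i j hij _ (hbJ i) _ (hbJ j)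
    have hbI : ∀ i, (b i).1 ∈ I i := fun i => timeVec_eq_of_enum hr hs i ▸ hT i (mem_univ i)
    have hbm : ∀ j, b j ∈ S ∩ lowerStrip t c := fun j => hr ▸ mem_range_self j
    refine ⟨fun i => ?_, ?_⟩
    · have : S ∩ I i ×ˢ J i = {b i} := by
        refine Subset.antisymm (fun a ha => ?_) (singleton_subset_iff.2
          ⟨(hbm i).1, hbI i, hbJ i⟩)
        have : a ∈ range b := by
          rw [hr]
          exact ⟨ha.1, hI i ha.2.1, hJ i ha.2.2⟩
        obtain ⟨j, rfl⟩ := this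
        have hj : (b j).2 ∈ J i := ha.2.2
        rcases lt_trichotomy i j with h | h | h
        · exact absurd (hlt i j h _ hj _ (hbJ j)) (lt_irrefl _)
        · rw [h]; rfl
        · exact absurd (hlt j i h _ (hbJ j) _ hj) (lt_irrefl _)
      rw [this, encard_singleton]
    · rw [encard_eq_zero, eq_empty_iff_forall_notMem]
      rintro a ⟨ha, haL, hau⟩
      have : a ∈ range b := by
        rw [hr]
        exact ⟨ha, haL⟩
      obtain ⟨j, rfl⟩ := this
      exact hau (mem_iUnion.2 ⟨j, hbI j, hbJ j⟩)
  · rintro ⟨h1, h0⟩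
    choose b hb using fun i => encard_eq_one.1 (h1 i)
    have hbm : ∀ i, b i ∈ S ∩ I i ×ˢ J i := fun i => (hb i).symm ▸ mem_singleton _
    have hs : StrictMono fun i => (b i).2 :=
      fun i j hij => hlt i j hij _ (hbm i).2.2 _ (hbm j).2.2
    have hinj : Function.Injective b := fun i j h => hs.injective (congrArg Prod.snd h)
    have hr : range b = S ∩ lowerStrip t c := by
      ext a
      constructor
      · rintro ⟨i, rfl⟩
        exact ⟨(hbm i).1, hI i (hbm i).2.1, hJ i (hbm i).2.2⟩
      · rintro ⟨ha, haL⟩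
        rw [encard_eq_zero, eq_empty_iff_forall_notMem] at h0
        by_contra hna
        refine h0 a ⟨ha, haL, fun hu => hna ?_⟩
        obtain ⟨i, hi⟩ := mem_iUnion.1 hu
        have : a ∈ S ∩ I i ×ˢ J i := ⟨ha, hi⟩
        rw [hb i] at this
        exact ⟨i, this.symm⟩
    refine ⟨?_, fun i _ => ?_, fun i _ => ?_⟩
    · rw [← hr, ← image_univ, hinj.encard_image, encard_univ]
      simp
    · rw [minVec_eq_of_enum hinj hr hs.monotone]
      exact (hbm i).2.2
    · rw [timeVec_eq_of_enum hr hs]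
      exact (hbm i).2.1

/-! ### Changing the heights below a level -/

/-- The configuration in which the values of the `m` lowest points are replaced, in the same order,
by fixed values below `c`. -/
noncomputable def respaced (S : Set (ℝ × ℝ)) (m : ℕ) (t c : ℝ) : Set (ℝ × ℝ) :=
  range (fun i : Fin m => (timeVec S m t i, c * i / m)) ∪ (S ∩ upperStrip t c)

/-- Respacing is an increasing change of the heights observed by time t: below c the new height is
c/m times the number of lower points, and from c on nothing moves. -/
theorem exists_respacing {S : Set (ℝ × ℝ)} (hS : S ⊆ quadrant) {t c : ℝ} (hc : 0 < c) {m : ℕ}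
    (hN : (S ∩ lowerStrip t c).encard = m) (hX : minVec S m t ∈ chamber m) :
    ∃ g : ℝ → ℝ, respaced S m t c = Prod.map id g '' (S ∩ {a | a.1 ≤ t}) ∧
      StrictMonoOn g (Prod.snd '' (S ∩ {a | a.1 ≤ t})) ∧
      (∀ y, c ≤ y → g y = y) ∧
      ∀ y ∈ Prod.snd '' (S ∩ {a | a.1 ≤ t}), y < c → 0 ≤ g y ∧ g y < c := by
  classical
  obtain ⟨b, hb, hr, hm⟩ := exists_enum hN
  have hXb := minVec_eq_of_enum hb hr hm
  have hs : StrictMono fun i => (b i).2 := fun i j hij => by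
    have := hX hij
    rwa [hXb, hXb] at this
  have hT := timeVec_eq_of_enum hr hs
  have hbm : ∀ j, b j ∈ S ∩ lowerStrip t c := fun j => hr ▸ mem_range_self j
  set g : ℝ → ℝ := fun y => if c ≤ y then y else
    c * (Finset.univ.filter fun j : Fin m => (b j).2 < y).card / m with hg
  have hgc : ∀ y, c ≤ y → g y = y := fun y hy => by simp [hg, hy]
  have hgb : ∀ i, g (b i).2 = c * i / m := by
    intro i
    have : (Finset.univ.filter fun j : Fin m => (b j).2 < (b i).2) = Finset.Iio i := by
      ext j
      simpa using hs.lt_iff_lt (a := j) (b := i)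
    simp only [hg, not_le.2 (hbm i).2.2.2, if_false, this, Fin.card_Iio]
  have hlow : ∀ a ∈ S ∩ {a | a.1 ≤ t}, a.2 < c → ∃ i, b i = a := by
    intro a ha hac
    have : a ∈ range b := by
      rw [hr]
      exact ⟨ha.1, ⟨(hS ha.1).1, ha.2⟩, (hS ha.1).2, hac⟩
    exact this
  have hgi : ∀ i : Fin m, 0 ≤ c * i / m ∧ c * i / m < c := by
    intro i
    have hmpos : (0 : ℝ) < m := by exact_mod_cast i.pos
    refine ⟨by positivity, ?_⟩
    rw [div_lt_iff₀ hmpos]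
    have : (i : ℝ) < m := by exact_mod_cast i.2
    nlinarith
  refine ⟨g, ?_, ?_, hgc, ?_⟩
  · ext p
    constructor
    · rintro (⟨i, rfl⟩ | ⟨hp, hpu⟩)
      · refine ⟨b i, ⟨(hbm i).1, (hbm i).2.1.2⟩, ?_⟩
        rw [Prod.map_apply', hgb, id, ← hT]
      · refine ⟨p, ⟨hp, hpu.1.2⟩, ?_⟩
        rw [Prod.map_apply', hgc _ hpu.2, id]
    · rintro ⟨a, ha, rfl⟩
      rcases lt_or_ge a.2 c with hac | hac
      · obtain ⟨i, rfl⟩ := hlow a ha hac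
        left
        refine ⟨i, ?_⟩
        rw [Prod.map_apply', hgb, id, ← hT]
      · right
        rw [Prod.map_apply', hgc _ hac, id]
        exact ⟨ha.1, ⟨(hS ha.1).1, ha.2⟩, hac⟩
  · rintro _ ⟨a, ha, rfl⟩ _ ⟨a', ha', rfl⟩ hlt
    rcases lt_or_ge a'.2 c with hac' | hac'
    · obtain ⟨i, rfl⟩ := hlow a ha (hlt.trans hac')
      obtain ⟨j, rfl⟩ := hlow a' ha' hac'
      rw [hgb, hgb]
      have hij : i < j := hs.lt_iff_lt.1 hlt
      have hmpos : (0 : ℝ) < m := by exact_mod_cast i.pos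
      have : (i : ℝ) < j := by exact_mod_cast hij
      gcongr
    · rw [hgc _ hac']
      rcases lt_or_ge a.2 c with hac | hac
      · obtain ⟨i, rfl⟩ := hlow a ha hac
        rw [hgb]
        exact (hgi i).2.trans_le hac'
      · rwa [hgc _ hac]
  · rintro _ ⟨a, ha, rfl⟩ hac
    obtain ⟨i, rfl⟩ := hlow a ha hac
    rw [hgb]
    exact hgi i

/-- Record times do not change under an increasing transformation of the values. -/
theorem recordTimes_map {S S' : Set (ℝ × ℝ)} {t : ℝ} {g : ℝ → ℝ}
    (h : S' = Prod.map id g '' (S ∩ {a | a.1 ≤ t}))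
    (hg : StrictMonoOn g (Prod.snd '' (S ∩ {a | a.1 ≤ t}))) (j : ℕ) :
    recordTimes S' j t = recordTimes S j t := by
  -- Points south-west of an atom seen by time t are seen before t, so discarding later points does
  -- no harm.
  have hsw : ∀ a ∈ S ∩ {a | a.1 ≤ t},
      (southWest S' (Prod.map id g a)).encard = (southWest S a).encard := by
    intro a ha
    have h1 : southWest S' (Prod.map id g a) = Prod.map id g '' southWest S a := by
      ext p
      constructor
      · rintro ⟨hp, hp1, hp2⟩
        rw [h] at hp
        obtain ⟨b, hb, rfl⟩ := hp
        exact ⟨b, ⟨hb.1, hp1, (hg.lt_iff_lt ⟨b, hb, rfl⟩ ⟨a, ha, rfl⟩).1 hp2⟩, rfl⟩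
      · rintro ⟨b, ⟨hb, hb1, hb2⟩, rfl⟩
        have hbt : b ∈ S ∩ {a | a.1 ≤ t} := ⟨hb, hb1.le.trans ha.2⟩
        exact ⟨h ▸ ⟨b, hbt, rfl⟩, hb1, (hg.lt_iff_lt ⟨b, hbt, rfl⟩ ⟨a, ha, rfl⟩).2 hb2⟩
    rw [h1]
    refine InjOn.encard_image fun b hb b' hb' hbb => ?_
    have h2 : b.1 = b'.1 := (Prod.ext_iff.1 hbb).1
    have h3 : g b.2 = g b'.2 := (Prod.ext_iff.1 hbb).2
    have hbt : b ∈ S ∩ {a | a.1 ≤ t} := ⟨hb.1, hb.2.1.le.trans ha.2⟩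
    have hbt' : b' ∈ S ∩ {a | a.1 ≤ t} := ⟨hb'.1, hb'.2.1.le.trans ha.2⟩
    exact Prod.ext h2 (hg.injOn ⟨b, hbt, rfl⟩ ⟨b', hbt', rfl⟩ h3)
  ext s
  constructor
  · rintro ⟨⟨p, ⟨hp, hpj⟩, rfl⟩, hst⟩
    rw [h] at hp
    obtain ⟨a, ha, rfl⟩ := hp
    rw [hsw a ha] at hpj
    exact ⟨⟨a, ⟨ha.1, hpj⟩, rfl⟩, hst⟩
  · rintro ⟨⟨a, ⟨ha, haj⟩, rfl⟩, hst⟩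
    have hat : a ∈ S ∩ {a | a.1 ≤ t} := ⟨ha, hst.2⟩
    rw [← hsw a hat] at haj
    exact ⟨⟨Prod.map id g a, ⟨h ▸ ⟨a, hat, rfl⟩, haj⟩, rfl⟩, hst⟩

theorem recordTimes_respaced {S : Set (ℝ × ℝ)} (hS : S ⊆ quadrant) {t c : ℝ} (hc : 0 < c) {m : ℕ}
    (hN : (S ∩ lowerStrip t c).encard = m) (hX : minVec S m t ∈ chamber m) (j : ℕ) :
    recordTimes (respaced S m t c) j t = recordTimes S j t := by
  obtain ⟨g, h, hg, -⟩ := exists_respacing hS hc hN hX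
  exact recordTimes_map h hg j

/-- Both configurations have at most m points below c, so neither collects m + 1 at a level under c;
at levels from c on their counts agree. Since the sets of levels coincide, times s with too few
points and default value 0 are covered. -/
theorem kthMin_respaced {S : Set (ℝ × ℝ)} (hS : S ⊆ quadrant) {t c : ℝ} (hc : 0 < c) {m : ℕ}
    (hN : (S ∩ lowerStrip t c).encard = m) (hX : minVec S m t ∈ chamber m) {s : ℝ} (hs : s ≤ t) :
    kthMin (respaced S m t c) (m + 1) s = kthMin S (m + 1) s := by
  obtain ⟨g, h, hg, hgc, hgl⟩ := exists_respacing hS hc hN hX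
  rw [kthMin_eq_sInf, kthMin_eq_sInf, h]
  congr 1
  ext x
  rcases lt_or_ge x c with hx | hx
  · have h1 : x ∉ countLevels S (m + 1) s := by
      intro hmem
      have : ((m + 1 : ℕ) : ℕ∞) ≤ (m : ℕ) := by
        refine le_trans hmem (le_trans (encard_le_encard ?_) hN.le)
        intro a ha
        exact ⟨ha.1, ⟨ha.2.1.1, ha.2.1.2.trans hs⟩, ha.2.2.1, ha.2.2.2.trans_lt hx⟩
      have : m + 1 ≤ m := by exact_mod_cast this
      omega
    have h2 : x ∉ countLevels (Prod.map id g '' (S ∩ {a | a.1 ≤ t})) (m + 1) s := by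
      intro hmem
      have : ((m + 1 : ℕ) : ℕ∞) ≤ (m : ℕ) := by
        refine le_trans hmem (le_trans (encard_le_encard (t := Prod.map id g ''
          (S ∩ lowerStrip t c)) ?_) ((encard_image_le _ _).trans hN.le))
        rintro _ ⟨⟨a, ha, rfl⟩, hbox⟩
        have hgx : g a.2 ≤ x := hbox.2.2
        refine ⟨a, ⟨ha.1, ⟨(hS ha.1).1, ha.2⟩, (hS ha.1).2, ?_⟩, rfl⟩
        by_contra hac
        rw [hgc _ (not_lt.1 hac)] at hgx
        exact hac (hgx.trans_lt hx)
      have : m + 1 ≤ m := by exact_mod_cast this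
      omega
    exact iff_of_false h2 h1
  · have h1 : Prod.map id g '' (S ∩ {a | a.1 ≤ t}) ∩ Icc 0 s ×ˢ Icc 0 x
        = Prod.map id g '' (S ∩ Icc 0 s ×ˢ Icc 0 x) := by
      ext p
      constructor
      · rintro ⟨⟨a, ha, rfl⟩, hbox⟩
        have hgx : g a.2 ≤ x := hbox.2.2
        refine ⟨a, ⟨ha.1, hbox.1, (hS ha.1).2, ?_⟩, rfl⟩
        rcases lt_or_ge a.2 c with hac | hac
        · exact (hac.trans_le hx).le
        · rwa [hgc _ hac] at hgx
      · rintro ⟨a, ⟨ha, ha1, ha2⟩, rfl⟩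
        have hat : a ∈ S ∩ {a | a.1 ≤ t} := ⟨ha, ha1.2.trans hs⟩
        refine ⟨⟨a, hat, rfl⟩, ha1, ?_⟩
        change g a.2 ∈ Icc 0 x
        rcases lt_or_ge a.2 c with hac | hac
        · have := hgl a.2 ⟨a, hat, rfl⟩ hac
          exact ⟨this.1, (this.2.trans_le hx).le⟩
        · rwa [hgc _ hac]
    have h2 : (Prod.map id g '' (S ∩ Icc 0 s ×ˢ Icc 0 x)).encard
        = (S ∩ Icc 0 s ×ˢ Icc 0 x).encard := by
      refine InjOn.encard_image fun b hb b' hb' hbb => ?_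
      have h2 : b.1 = b'.1 := (Prod.ext_iff.1 hbb).1
      have h3 : g b.2 = g b'.2 := (Prod.ext_iff.1 hbb).2
      exact Prod.ext h2 (hg.injOn ⟨b, ⟨hb.1, hb.2.1.2.trans hs⟩, rfl⟩
        ⟨b', ⟨hb'.1, hb'.2.1.2.trans hs⟩, rfl⟩ h3)
    simp only [countLevels, mem_ofPred_eq, h1, h2]

/-! ### Independence and box probabilities for the Poisson process -/

/-- The numbers of points in all Borel subsets of a region `U`. -/
noncomputable def countProcess {Ω : Type*} (P : Ω → Set (ℝ × ℝ)) (U : Set (ℝ × ℝ)) (ω : Ω) :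
    {C : Set (ℝ × ℝ) // MeasurableSet C ∧ C ⊆ U} → ℕ∞ :=
  fun C => (P ω ∩ C).encard

namespace IsUnitPoissonQuadrant

variable {Ω : Type*} [mΩ : MeasurableSpace Ω] {μ : Measure Ω} {P : Ω → Set (ℝ × ℝ)}

theorem isMeasurableConfig (hP : IsUnitPoissonQuadrant P μ) : IsMeasurableConfig P :=
  ⟨hP.locallyFinite, hP.measurable_count⟩

theorem measurable_countProcess (hP : IsUnitPoissonQuadrant P μ) (U : Set (ℝ × ℝ)) :
    Measurable (countProcess P U) :=
  measurable_pi_lambda _ fun C => hP.measurable_count _ C.2.1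

theorem indep_counts (hP : IsUnitPoissonQuadrant P μ) {κ : Type*} [Finite κ]
    {B : κ → Set (ℝ × ℝ)} (hB : ∀ i, MeasurableSet (B i)) (hq : ∀ i, B i ⊆ quadrant)
    (hd : Pairwise fun i j => Disjoint (B i) (B j)) :
    iIndepFun (fun i ω => (P ω ∩ B i).encard) μ := by
  obtain ⟨n, ⟨e⟩⟩ := Finite.exists_equiv_fin κ
  refine iIndepFun.of_precomp e.symm.surjective ?_
  exact hP.indep_count n (fun i => B (e.symm i)) (fun i => hB _) (fun i => hq _)
    fun i j hij => hd fun h => hij (e.symm.injective h)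

/-- Independence is assumed for finitely many disjoint sets only. Finitely many subsets of U cut it
into finitely many disjoint cells, and their counts are sums of cell counts; finite subfamilies then
determine independence of the whole process. -/
theorem indepFun_countProcess (hP : IsUnitPoissonQuadrant P μ) [IsProbabilityMeasure μ]
    {κ : Type*} [Fintype κ] {B : κ → Set (ℝ × ℝ)} (hB : ∀ i, MeasurableSet (B i))
    (hq : ∀ i, B i ⊆ quadrant) (hd : Pairwise fun i j => Disjoint (B i) (B j))
    {U : Set (ℝ × ℝ)} (hUm : MeasurableSet U) (hU : U ⊆ quadrant)
    (hBU : ∀ i, Disjoint (B i) U) :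
    IndepFun (fun ω i => (P ω ∩ B i).encard) (countProcess P U) μ := by
  classical
  refine IndepFun.indepFun_process
    (Y := fun (C : {C : Set (ℝ × ℝ) // MeasurableSet C ∧ C ⊆ U}) ω => (P ω ∩ C).encard)
    (measurable_pi_lambda _ fun i => hP.measurable_count _ (hB i))
    (fun C => hP.measurable_count _ C.2.1) fun F => ?_
  -- The cell with membership pattern s with respect to the sets in F.
  let D : (F → Bool) → Set (ℝ × ℝ) := fun s =>
    U ∩ ⋂ C : F, if s C then (C.1 : Set (ℝ × ℝ)) else (C.1 : Set (ℝ × ℝ))ᶜ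
  have hDm : ∀ s, MeasurableSet (D s) := fun s => hUm.inter <| MeasurableSet.iInter fun C => by
    split_ifs
    · exact C.1.2.1
    · exact C.1.2.1.compl
  have hDd : Pairwise fun s s' => Disjoint (D s) (D s') := by
    intro s s' hne
    refine disjoint_left.2 fun a ha ha' => hne ?_
    ext C
    have h1 := mem_iInter.1 ha.2 C
    have h2 := mem_iInter.1 ha'.2 C
    cases hs : s C <;> cases hs' : s' C <;> simp_all
  have hC : ∀ C : F, (C.1 : Set (ℝ × ℝ)) = ⋃ s : {s : F → Bool // s C = true}, D s := by
    intro C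
    ext a
    constructor
    · intro ha
      refine mem_iUnion.2 ⟨⟨fun C' => decide (a ∈ (C'.1 : Set (ℝ × ℝ))), by simpa using ha⟩,
        C.1.2.2 ha, mem_iInter.2 fun C' => ?_⟩
      by_cases h : a ∈ (C'.1 : Set (ℝ × ℝ)) <;> simp [h]
    · intro ha
      obtain ⟨s, hs⟩ := mem_iUnion.1 ha
      have := mem_iInter.1 hs.2 C
      rwa [if_pos s.2] at this
  have hcount : ∀ ω, ∀ C : F, (P ω ∩ C.1).encard
      = ∑ s : {s : F → Bool // s C = true}, (P ω ∩ D s).encard := by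
    intro ω C
    conv_lhs => rw [hC C, inter_iUnion]
    rw [encard_iUnion_of_finite, finsum_eq_sum_of_fintype]
    intro s s' hne
    exact (hDd fun h => hne (Subtype.ext h)).mono inter_subset_right inter_subset_right
  let G : κ ⊕ (F → Bool) → Set (ℝ × ℝ) := Sum.elim B D
  have hGm : ∀ i, MeasurableSet (G i) := by
    rintro (i | s)
    · exact hB i
    · exact hDm s
  have hind : iIndepFun (fun i ω => (P ω ∩ G i).encard) μ := by
    refine hP.indep_counts hGm ?_ ?_
    · rintro (i | s)
      · exact hq i
      · exact inter_subset_left.trans hU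
    · rintro (i | s) (j | s') hne
      · exact hd fun h => hne (h ▸ rfl)
      · exact (hBU i).mono_right inter_subset_left
      · exact ((hBU j).mono_right inter_subset_left).symm
      · exact hDd fun h => hne (h ▸ rfl)
  have h2 := hind.indepFun_finset (Finset.univ.map Function.Embedding.inl)
    (Finset.univ.map Function.Embedding.inr)
    (by rw [Finset.disjoint_left]; simp) (fun i => hP.measurable_count _ (hGm i))
  have h3 := h2.comp
    (φ := fun x i => x ⟨Sum.inl i, by simp⟩)
    (ψ := fun x (C : F) => ∑ s : {s : F → Bool // s C = true}, x ⟨Sum.inr s.1, by simp⟩)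
    (measurable_of_countable _) (measurable_of_countable _)
  have he : (fun ω (C : F) => (P ω ∩ C.1).encard)
      = fun ω C => ∑ s : {s : F → Bool // s C = true}, (P ω ∩ D s).encard :=
    funext fun ω => funext (hcount ω)
  rw [he]
  exact h3

theorem measure_count_eq (hP : IsUnitPoissonQuadrant P μ) {B : Set (ℝ × ℝ)}
    (hB : MeasurableSet B) (hq : B ⊆ quadrant) (hv : volume B ≠ ⊤) (n : ℕ) :
    μ {ω | (P ω ∩ B).encard = n}
      = ENNReal.ofReal (Real.exp (-(volume.real B)) * (volume.real B) ^ n / n.factorial) := by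
  have h := congrArg (fun ν => ν {(n : ℕ∞)}) (hP.law_count B hB hq hv)
  rw [Measure.map_apply (hP.measurable_count B hB) (measurableSet_singleton _),
    Measure.map_apply (measurable_of_countable _) (measurableSet_singleton _)] at h
  have h2 : (fun n : ℕ => (n : ℕ∞)) ⁻¹' {(n : ℕ∞)} = {n} := by
    ext x; simp
  rw [h2, poissonMeasure_singleton] at h
  exact h

theorem lowerStrip_subset_quadrant (t c : ℝ) : lowerStrip t c ⊆ quadrant :=
  prod_mono Icc_subset_Ici_self Ico_subset_Ici_self

theorem upperStrip_subset_quadrant {c : ℝ} (hc : 0 ≤ c) (t : ℝ) : upperStrip t c ⊆ quadrant :=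
  prod_mono Icc_subset_Ici_self (Ici_subset_Ici.2 hc)

theorem disjoint_lowerStrip_upperStrip (t c : ℝ) :
    Disjoint (lowerStrip t c) (upperStrip t c) :=
  disjoint_left.2 fun _ h h' => absurd h.2.2 (not_lt.2 h'.2)

theorem volume_lowerStrip (t c : ℝ) :
    volume (lowerStrip t c) = ENNReal.ofReal t * ENNReal.ofReal c := by
  rw [lowerStrip, Measure.volume_eq_prod, Measure.prod_prod, Real.volume_Icc, Real.volume_Ico,
    sub_zero, sub_zero]

/-- Joint probability of one point in each of disjoint boxes of the lower strip, no further point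
in the lower strip, and an event depending on the upper strip. -/
theorem measure_boxes (hP : IsUnitPoissonQuadrant P μ) [IsProbabilityMeasure μ] {t c : ℝ}
    (ht : 0 ≤ t) (hc : 0 ≤ c) {κ : Type*} [Fintype κ] {B : κ → Set (ℝ × ℝ)}
    (hB : ∀ i, MeasurableSet (B i)) (hL : ∀ i, B i ⊆ lowerStrip t c)
    (hd : Pairwise fun i j => Disjoint (B i) (B j))
    {G : Set ({C : Set (ℝ × ℝ) // MeasurableSet C ∧ C ⊆ upperStrip t c} → ℕ∞)}
    (hG : MeasurableSet G) :
    μ ({ω | (∀ i, (P ω ∩ B i).encard = 1) ∧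
        (P ω ∩ (lowerStrip t c \ ⋃ i, B i)).encard = 0} ∩ countProcess P (upperStrip t c) ⁻¹' G)
      = ENNReal.ofReal (Real.exp (-(t * c))) * (∏ i, volume (B i)) *
        μ (countProcess P (upperStrip t c) ⁻¹' G) := by
  classical
  have hvol : volume (lowerStrip t c) ≠ ⊤ := by
    rw [volume_lowerStrip]; exact ENNReal.mul_ne_top ENNReal.ofReal_ne_top ENNReal.ofReal_ne_top
  let R := lowerStrip t c \ ⋃ i, B i
  have hRm : MeasurableSet R := (measurableSet_lowerStrip t c).diff (MeasurableSet.iUnion hB)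
  have hRL : R ⊆ lowerStrip t c := sdiff_subset
  -- The index `none` stands for the rest of the strip, so the D o partition it.
  let D : Option κ → Set (ℝ × ℝ) := fun o => o.elim R B
  have hDm : ∀ o, MeasurableSet (D o) := by
    rintro (_ | i)
    · exact hRm
    · exact hB i
  have hDL : ∀ o, D o ⊆ lowerStrip t c := by
    rintro (_ | i)
    · exact hRL
    · exact hL i
  have hDd : Pairwise fun o o' => Disjoint (D o) (D o') := by
    have hR : ∀ i, Disjoint R (B i) := fun i => disjoint_left.2 fun a ha hb =>
      ha.2 (mem_iUnion.2 ⟨i, hb⟩)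
    rintro (_ | i) (_ | j) hne
    · exact absurd rfl hne
    · exact hR j
    · exact (hR i).symm
    · exact hd fun h => hne (h ▸ rfl)
  have hDU : ⋃ o, D o = lowerStrip t c := by
    rw [iUnion_option]
    exact sdiff_union_of_subset (iUnion_subset hL)
  let v : Option κ → ℕ := fun o => o.elim 0 fun _ => 1
  have hind := hP.indepFun_countProcess hDm (fun o => (hDL o).trans (lowerStrip_subset_quadrant t c))
    hDd (measurableSet_upperStrip t c) (upperStrip_subset_quadrant hc t)
    fun o => (disjoint_lowerStrip_upperStrip t c).mono_left (hDL o)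
  have hset : {ω | (∀ i, (P ω ∩ B i).encard = 1) ∧ (P ω ∩ R).encard = 0}
      = (fun ω o => (P ω ∩ D o).encard) ⁻¹' {fun o => ((v o : ℕ) : ℕ∞)} := by
    ext ω
    simp only [mem_ofPred_eq, mem_preimage, mem_singleton_iff, funext_iff, Option.forall]
    rw [and_comm]
    simp [D, v]
  have hfin : ∀ o, volume (D o) ≠ ⊤ := fun o => measure_ne_top_of_subset (hDL o) hvol
  have hsum : ∑ o, volume.real (D o) = t * c := by
    rw [← measureReal_iUnion_fintype hDd hDm hfin, hDU, measureReal_def, volume_lowerStrip,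
      ENNReal.toReal_mul, ENNReal.toReal_ofReal ht, ENNReal.toReal_ofReal hc]
  have hset2 : (fun ω o => (P ω ∩ D o).encard) ⁻¹' {fun o => ((v o : ℕ) : ℕ∞)}
      = ⋂ o, (fun ω => (P ω ∩ D o).encard) ⁻¹' {((v o : ℕ) : ℕ∞)} := by
    ext ω
    simp [funext_iff]
  rw [show lowerStrip t c \ ⋃ i, B i = R from rfl, hset,
    hind.measure_inter_preimage_eq_mul _ _ (measurableSet_singleton _) hG, hset2,
    (hP.indep_counts hDm (fun o => (hDL o).trans (lowerStrip_subset_quadrant t c))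
      hDd).meas_iInter fun o => ⟨_, measurableSet_singleton _, rfl⟩]
  congr 1
  -- The prescribed counts are 0 or 1, so the factorials are 1; the exponents add up to the area tc
  -- of the strip.
  have hprod : ∀ o, μ ((fun ω => (P ω ∩ D o).encard) ⁻¹' {((v o : ℕ) : ℕ∞)})
      = ENNReal.ofReal (Real.exp (-(volume.real (D o)))) * volume (D o) ^ v o := by
    intro o
    refine (hP.measure_count_eq (hDm o) ((hDL o).trans (lowerStrip_subset_quadrant t c))
      (hfin o) (v o)).trans ?_
    have hv : (v o).factorial = 1 := by rcases o with _ | i <;> rfl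
    rw [hv, Nat.cast_one, div_one, ENNReal.ofReal_mul (Real.exp_nonneg _),
      ENNReal.ofReal_pow measureReal_nonneg, ofReal_measureReal (hfin o)]
  rw [Finset.prod_congr rfl fun o _ => hprod o, Finset.prod_mul_distrib,
    ← ENNReal.ofReal_prod_of_nonneg (fun _ _ => Real.exp_nonneg _), ← Real.exp_sum,
    Finset.sum_neg_distrib, hsum, Fintype.prod_option]
  simp [D, v]

theorem measurable_minVec (hP : IsUnitPoissonQuadrant P μ) (n : ℕ) (t : ℝ) :
    Measurable fun ω => minVec (P ω) n t :=
  measurable_pi_lambda _ fun i => hP.isMeasurableConfig.measurable_kthMin (by omega) t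

theorem measurable_kthTime (hP : IsUnitPoissonQuadrant P μ) {k : ℕ} (hk : 1 ≤ k) (t : ℝ) :
    Measurable fun ω => kthTime (P ω) k t := by
  have hX := hP.isMeasurableConfig.measurable_kthMin hk t
  have hbase : MeasurableSet {p : Ω × (ℝ × ℝ) | p.2.2 = kthMin (P p.1) k t ∧ p.2.1 ∈ Icc 0 t} :=
    (measurableSet_eq_fun (f := fun p : Ω × (ℝ × ℝ) => p.2.2)
      (g := fun p => kthMin (P p.1) k t) (by fun_prop) (hX.comp measurable_fst)).inter
      ((by fun_prop : Measurable fun p : Ω × (ℝ × ℝ) => p.2.1) measurableSet_Icc)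
  refine measurable_of_Iio fun y => ?_
  have hy : MeasurableSet {p : Ω × (ℝ × ℝ) | p.2.1 < y} :=
    measurableSet_lt (by fun_prop) measurable_const
  have h1 := hP.isMeasurableConfig.measurableSet_exists (hbase.inter hy)
  have h2 := hP.isMeasurableConfig.measurableSet_exists hbase
  -- The second set is the case without admissible time, where the infimum is 0 by default.
  convert h1.union (h2.compl.inter (MeasurableSet.const (0 < y))) using 1
  ext ω
  simp only [mem_preimage, mem_Iio, mem_union, mem_inter_iff, mem_compl_iff, mem_ofPred_eq,
    kthTime]
  set V := {s | (s, kthMin (P ω) k t) ∈ P ω ∧ s ∈ Icc 0 t} with hV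
  by_cases hne : V.Nonempty
  · have hbdd : BddBelow V := ⟨0, fun s hs => hs.2.1⟩
    rw [csInf_lt_iff hbdd hne]
    constructor
    · rintro ⟨s, ⟨hs, hst⟩, hsy⟩
      exact Or.inl ⟨(s, _), hs, ⟨rfl, hst⟩, hsy⟩
    · rintro (⟨a, ha, ⟨ha2, hat⟩, hay⟩ | ⟨hno, -⟩)
      · exact ⟨a.1, ⟨by rw [← ha2]; exact ha, hat⟩, hay⟩
      · obtain ⟨s, hs, hst⟩ := hne
        exact absurd ⟨(s, _), hs, rfl, hst⟩ hno
  · rw [not_nonempty_iff_eq_empty] at hne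
    have hno : ¬ ∃ a ∈ P ω, a.2 = kthMin (P ω) k t ∧ a.1 ∈ Icc 0 t := by
      rintro ⟨a, ha, ha2, hat⟩
      have : a.1 ∈ V := ⟨by rw [← ha2]; exact ha, hat⟩
      rw [hne] at this
      exact this
    rw [hne, Real.sInf_empty]
    constructor
    · exact fun h => Or.inr ⟨hno, h⟩
    · rintro (⟨a, ha, hb, -⟩ | h)
      · exact absurd ⟨a, ha, hb⟩ hno
      · exact h.2

theorem measurable_timeVec (hP : IsUnitPoissonQuadrant P μ) (n : ℕ) (t : ℝ) :
    Measurable fun ω => timeVec (P ω) n t :=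
  measurable_pi_lambda _ fun i => hP.measurable_kthTime (by omega) t

end IsUnitPoissonQuadrant

/-! ### Joint law of heights, times and upper points at a fixed level -/

namespace IsUnitPoissonQuadrant

/-- The event that there are exactly `m` points in the lower strip. -/
def lowerEvent {Ω : Type*} (P : Ω → Set (ℝ × ℝ)) (m : ℕ) (t c : ℝ) : Set Ω :=
  {ω | (P ω ∩ lowerStrip t c).encard = m}

theorem minVec_mem_Ico {Ω : Type*} {P : Ω → Set (ℝ × ℝ)} {m : ℕ} {t c : ℝ} {ω : Ω}
    (h : ω ∈ lowerEvent P m t c) (i : Fin m) :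
    minVec (P ω) m t i ∈ Ico 0 c := by
  obtain ⟨b, hb, hr, hm⟩ := exists_enum h
  rw [minVec_eq_of_enum hb hr hm]
  exact (hr ▸ mem_range_self i : b i ∈ P ω ∩ lowerStrip t c).2.2

theorem timeVec_mem_Icc {Ω : Type*} {P : Ω → Set (ℝ × ℝ)} {m : ℕ} {t c : ℝ} {ω : Ω}
    (h : ω ∈ lowerEvent P m t c) (hX : minVec (P ω) m t ∈ chamber m) (i : Fin m) : timeVec (P ω) m t i ∈ Icc 0 t := by
  obtain ⟨b, hb, hr, hm⟩ := exists_enum h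
  have hXb := minVec_eq_of_enum hb hr hm
  have hs : StrictMono fun i => (b i).2 := fun i j hij => by
    have := hX hij
    rwa [hXb, hXb] at this
  rw [timeVec_eq_of_enum hr hs]
  exact (hr ▸ mem_range_self i : b i ∈ P ω ∩ lowerStrip t c).2.1

variable {Ω : Type*} [mΩ : MeasurableSpace Ω] {μ : Measure Ω} {P : Ω → Set (ℝ × ℝ)}

theorem measurableSet_lowerEvent (hP : IsUnitPoissonQuadrant P μ) (m : ℕ) (t c : ℝ) :
    MeasurableSet (lowerEvent P m t c) :=
  hP.measurable_count _ (measurableSet_lowerStrip t c) (measurableSet_singleton (m : ℕ∞))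

/-- Joint law of the values and times of the `m` points of the lower strip and of the points of the
upper strip, on boxes. -/
theorem measure_minVec_timeVec_boxes (hP : IsUnitPoissonQuadrant P μ) [IsProbabilityMeasure μ]
    {t c : ℝ} (ht : 0 ≤ t) (hc : 0 ≤ c) {m : ℕ} {I J : Fin m → Set ℝ}
    (hIm : ∀ i, MeasurableSet (I i)) (hI : ∀ i, I i ⊆ Icc 0 t)
    (hJm : ∀ i, MeasurableSet (J i)) (hJ : univ.pi J ⊆ chamber m)
    {G : Set ({C : Set (ℝ × ℝ) // MeasurableSet C ∧ C ⊆ upperStrip t c} → ℕ∞)}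
    (hG : MeasurableSet G) :
    μ ({ω | ω ∈ lowerEvent P m t c ∧ minVec (P ω) m t ∈ univ.pi J ∧
        timeVec (P ω) m t ∈ univ.pi I} ∩ countProcess P (upperStrip t c) ⁻¹' G)
      = ENNReal.ofReal (Real.exp (-(t * c))) *
        ((∏ i, volume (I i)) * ∏ i, volume (J i ∩ Ico 0 c)) *
        μ (countProcess P (upperStrip t c) ⁻¹' G) := by
  have hJm' : ∀ i, MeasurableSet (J i ∩ Ico 0 c) := fun i => (hJm i).inter measurableSet_Ico
  have hJ' : univ.pi (fun i => J i ∩ Ico 0 c) ⊆ chamber m := by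
    rw [pi_inter_distrib]
    exact inter_subset_left.trans hJ
  have hset : {ω | ω ∈ lowerEvent P m t c ∧ minVec (P ω) m t ∈ univ.pi J ∧
        timeVec (P ω) m t ∈ univ.pi I} = {ω | ω ∈ lowerEvent P m t c ∧
        minVec (P ω) m t ∈ univ.pi (fun i => J i ∩ Ico 0 c) ∧
        timeVec (P ω) m t ∈ univ.pi I} := by
    ext ω
    simp only [mem_ofPred_eq]
    constructor
    · rintro ⟨h, hx, hT⟩
      exact ⟨h, fun i hi => ⟨hx i hi, minVec_mem_Ico h i⟩, hT⟩
    · rintro ⟨h, hx, hT⟩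
      exact ⟨h, fun i hi => (hx i hi).1, hT⟩
  rw [hset]
  -- Sides of a box are ordered only if the box is nonempty; for an empty box both sides vanish.
  rcases (univ.pi fun i => J i ∩ Ico 0 c).eq_empty_or_nonempty with hemp | hne
  · obtain ⟨i, hi⟩ := univ_pi_eq_empty_iff.1 hemp
    rw [hemp, Finset.prod_eq_zero (f := fun i => volume (J i ∩ Ico 0 c)) (Finset.mem_univ i)
      (by rw [hi, measure_empty])]
    simp
  · have hlt : ∀ i j, i < j → ∀ x ∈ J i ∩ Ico 0 c, ∀ y ∈ J j ∩ Ico 0 c, x < y :=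
      fun i j hij x hx y hy => box_lt hJ' hne hij hx hy
    have hset2 : {ω | ω ∈ lowerEvent P m t c ∧
        minVec (P ω) m t ∈ univ.pi (fun i => J i ∩ Ico 0 c) ∧ timeVec (P ω) m t ∈ univ.pi I}
        = {ω | (∀ i, (P ω ∩ I i ×ˢ (J i ∩ Ico 0 c)).encard = 1) ∧
        (P ω ∩ (lowerStrip t c \ ⋃ i, I i ×ˢ (J i ∩ Ico 0 c))).encard = 0} := by
      ext ω
      exact mem_boxes_iff hI (fun i => inter_subset_right) hlt
    rw [hset2, hP.measure_boxes ht hc (B := fun i => I i ×ˢ (J i ∩ Ico 0 c))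
      (fun i => (hIm i).prod (hJm' i)) (fun i => prod_mono (hI i) inter_subset_right) ?_ hG]
    · simp only [Measure.volume_eq_prod, Measure.prod_prod, Finset.prod_mul_distrib]
    · intro i j hij
      refine disjoint_left.2 fun a ha hb => ?_
      rcases lt_or_gt_of_ne hij with h | h
      · exact lt_irrefl _ (hlt i j h _ ha.2 _ hb.2)
      · exact lt_irrefl _ (hlt j i h _ hb.2 _ ha.2)

/-- Joint law of the values and times of the `m` points of the lower strip and of the points of the
upper strip, as long as the values are distinct. -/
theorem measure_minVec_chamber (hP : IsUnitPoissonQuadrant P μ) [IsProbabilityMeasure μ]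
    {t c : ℝ} (ht : 0 ≤ t) (hc : 0 < c) {m : ℕ} {I : Fin m → Set ℝ}
    (hIm : ∀ i, MeasurableSet (I i)) (hI : ∀ i, I i ⊆ Icc 0 t)
    {G : Set ({C : Set (ℝ × ℝ) // MeasurableSet C ∧ C ⊆ upperStrip t c} → ℕ∞)}
    (hG : MeasurableSet G) {A : Set (Fin m → ℝ)} (hA : MeasurableSet A) :
    μ ({ω | ω ∈ lowerEvent P m t c ∧ minVec (P ω) m t ∈ A ∩ chamber m ∧
        timeVec (P ω) m t ∈ univ.pi I} ∩ countProcess P (upperStrip t c) ⁻¹' G)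
      = ENNReal.ofReal (Real.exp (-(t * c))) * (∏ i, volume (I i)) *
        μ (countProcess P (upperStrip t c) ⁻¹' G) *
        (ENNReal.ofReal c ^ m * (m.factorial : ENNReal)⁻¹) * uniformOrderStatLaw m c A := by
  -- The factor c^m / m! undoes the m! and the normalisations 1/c in the box formula for the order
  -- statistics.
  set K := ENNReal.ofReal (Real.exp (-(t * c))) * (∏ i, volume (I i)) *
        μ (countProcess P (upperStrip t c) ⁻¹' G) *
        (ENNReal.ofReal c ^ m * (m.factorial : ENNReal)⁻¹) with hK
  set E := lowerEvent P m t c ∩ (fun ω => timeVec (P ω) m t) ⁻¹' univ.pi I ∩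
    countProcess P (upperStrip t c) ⁻¹' G with hE
  have hEm : MeasurableSet E := ((hP.measurableSet_lowerEvent m t c).inter
    (hP.measurable_timeVec m t (MeasurableSet.univ_pi hIm))).inter (hP.measurable_countProcess _ hG)
  have hX := hP.measurable_minVec m t
  have hν : ∀ B, MeasurableSet B → (μ.restrict E).map (fun ω => minVec (P ω) m t) B
      = μ ({ω | ω ∈ lowerEvent P m t c ∧ minVec (P ω) m t ∈ B ∧
        timeVec (P ω) m t ∈ univ.pi I} ∩ countProcess P (upperStrip t c) ⁻¹' G) := by
    intro B hB
    rw [Measure.map_apply hX hB, Measure.restrict_apply (hX hB)]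
    congr 1
    ext ω
    simp only [hE, mem_inter_iff, mem_preimage, mem_ofPred_eq]
    tauto
  have h1 : ((μ.restrict E).map (fun ω => minVec (P ω) m t)).restrict (chamber m)
      = (K • uniformOrderStatLaw m c).restrict (chamber m) := by
    refine restrict_chamber_ext fun J hJm hJ => ?_
    rw [hν _ (MeasurableSet.univ_pi hJm),
      hP.measure_minVec_timeVec_boxes ht hc.le hIm hI hJm hJ hG, Measure.smul_apply, smul_eq_mul,
      uniformOrderStatLaw_box hc hJm hJ]
    have h2 : ∀ i, volume[|Icc 0 c] (J i) = (ENNReal.ofReal c)⁻¹ * volume (J i ∩ Ico 0 c) := by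
      intro i
      rw [cond_apply measurableSet_Icc, Real.volume_Icc, sub_zero, inter_comm]
      congr 1
      exact measure_congr ((Filter.EventuallyEq.refl _ _).inter Ico_ae_eq_Icc.symm)
    have h3 : ENNReal.ofReal c ^ m * (ENNReal.ofReal c)⁻¹ ^ m = 1 := by
      rw [← mul_pow, ENNReal.mul_inv_cancel (by simpa using hc) ENNReal.ofReal_ne_top, one_pow]
    have h4 : (m.factorial : ENNReal)⁻¹ * m.factorial = 1 :=
      ENNReal.inv_mul_cancel (by exact_mod_cast m.factorial_ne_zero) (ENNReal.natCast_ne_top _)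
    simp only [h2, Finset.prod_mul_distrib, Finset.prod_const, Finset.card_univ, Fintype.card_fin]
    calc _ = ENNReal.ofReal (Real.exp (-(t * c))) * (∏ i, volume (I i)) *
        μ (countProcess P (upperStrip t c) ⁻¹' G) * (∏ i, volume (J i ∩ Ico 0 c)) *
        (ENNReal.ofReal c ^ m * (ENNReal.ofReal c)⁻¹ ^ m) *
        ((m.factorial : ENNReal)⁻¹ * m.factorial) := by rw [h3, h4]; ring
      _ = _ := by rw [hK]; ring
  have h5 := congrArg (fun ν => ν A) h1
  simp only [Measure.restrict_apply hA] at h5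
  rw [hν _ (hA.inter (measurableSet_chamber m)), Measure.smul_apply, smul_eq_mul] at h5
  rw [h5]
  congr 1
  exact measure_inter_conull (uniformOrderStatLaw_chamber_compl m hc)

/-- The values observed in a bounded strip are almost surely distinct. -/
theorem ae_minVec_mem_chamber (hP : IsUnitPoissonQuadrant P μ) [IsProbabilityMeasure μ]
    {t c : ℝ} (ht : 0 ≤ t) (hc : 0 < c) (m : ℕ) :
    ∀ᵐ ω ∂μ, ω ∈ lowerEvent P m t c → minVec (P ω) m t ∈ chamber m := by
  have hX := hP.measurable_minVec m t
  have hEm := hP.measurableSet_lowerEvent m t c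
  have h1 := hP.measure_minVec_chamber (m := m) ht hc (I := fun _ => Icc 0 t)
    (fun i => measurableSet_Icc) (fun i => Subset.rfl) MeasurableSet.univ MeasurableSet.univ
  have := isProbabilityMeasure_uniformOrderStatLaw m hc
  have h2 : volume.real (lowerStrip t c) = t * c := by
    rw [measureReal_def, volume_lowerStrip, ENNReal.toReal_mul, ENNReal.toReal_ofReal ht,
      ENNReal.toReal_ofReal hc.le]
  have h3 : μ (lowerEvent P m t c) = ENNReal.ofReal (Real.exp (-(t * c))) *
      (ENNReal.ofReal t ^ m * (ENNReal.ofReal c ^ m * (m.factorial : ENNReal)⁻¹)) := by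
    refine (hP.measure_count_eq (measurableSet_lowerStrip t c) (lowerStrip_subset_quadrant t c)
      (by rw [volume_lowerStrip]
          exact ENNReal.mul_ne_top ENNReal.ofReal_ne_top ENNReal.ofReal_ne_top) m).trans ?_
    rw [h2, mul_div_assoc, ENNReal.ofReal_mul (Real.exp_nonneg _), mul_pow,
      ENNReal.ofReal_div_of_pos (by positivity), ENNReal.ofReal_mul (by positivity),
      ENNReal.ofReal_pow ht, ENNReal.ofReal_pow hc.le, ENNReal.ofReal_natCast, div_eq_mul_inv,
      mul_assoc (ENNReal.ofReal t ^ m)]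
  -- With no restriction on heights and times, the chamber already carries exp(-tc) (tc)^m / m!, the
  -- full Poisson probability of m points. Nothing is left for ties.
  have h4 : μ (lowerEvent P m t c) ≤
      μ (lowerEvent P m t c ∩ (fun ω => minVec (P ω) m t) ⁻¹' chamber m) := by
    rw [h3]
    refine le_trans (le_of_eq ?_) (h1.symm.le.trans (measure_mono ?_))
    · simp only [Finset.prod_const, Finset.card_univ, Fintype.card_fin, Real.volume_Icc, sub_zero,
        preimage_univ, measure_univ, mul_one, mul_assoc]
    · rintro ω ⟨⟨hω, hx, -⟩, -⟩
      exact ⟨hω, hx.2⟩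
  have h5 : μ (lowerEvent P m t c \ (fun ω => minVec (P ω) m t) ⁻¹' chamber m) = 0 := by
    rw [← sdiff_self_inter, measure_sdiff inter_subset_left
      (hEm.inter (hX (measurableSet_chamber m))).nullMeasurableSet (measure_ne_top _ _)]
    exact tsub_eq_zero_of_le h4
  filter_upwards [measure_eq_zero_iff_ae_notMem.1 h5] with ω hω hE
  by_contra hx
  exact hω ⟨hE, hx⟩

/-- Ties being null, the chamber formula holds without the chamber; its constant does not involve A,
so the case of all A identifies it. -/
theorem measure_minVec_timeVec (hP : IsUnitPoissonQuadrant P μ) [IsProbabilityMeasure μ]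
    {t c : ℝ} (ht : 0 ≤ t) (hc : 0 < c) {m : ℕ} {I : Fin m → Set ℝ}
    (hIm : ∀ i, MeasurableSet (I i))
    {G : Set ({C : Set (ℝ × ℝ) // MeasurableSet C ∧ C ⊆ upperStrip t c} → ℕ∞)}
    (hG : MeasurableSet G) {A : Set (Fin m → ℝ)} (hA : MeasurableSet A) :
    μ {ω | ω ∈ lowerEvent P m t c ∧ minVec (P ω) m t ∈ A ∧
        timeVec (P ω) m t ∈ univ.pi I ∧ countProcess P (upperStrip t c) ω ∈ G}
      = uniformOrderStatLaw m c A * μ {ω | ω ∈ lowerEvent P m t c ∧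
        timeVec (P ω) m t ∈ univ.pi I ∧ countProcess P (upperStrip t c) ω ∈ G} := by
  have := isProbabilityMeasure_uniformOrderStatLaw m hc
  have key : ∀ A : Set (Fin m → ℝ), MeasurableSet A → μ {ω | ω ∈ lowerEvent P m t c ∧
      minVec (P ω) m t ∈ A ∧
      timeVec (P ω) m t ∈ univ.pi I ∧ countProcess P (upperStrip t c) ω ∈ G}
      = ENNReal.ofReal (Real.exp (-(t * c))) * (∏ i, volume (I i ∩ Icc 0 t)) *
        μ (countProcess P (upperStrip t c) ⁻¹' G) *
        (ENNReal.ofReal c ^ m * (m.factorial : ENNReal)⁻¹) * uniformOrderStatLaw m c A := by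
    intro A hA
    rw [← hP.measure_minVec_chamber ht hc (fun i => (hIm i).inter measurableSet_Icc)
      (fun i => inter_subset_right) hG hA]
    refine measure_congr ?_
    filter_upwards [hP.ae_minVec_mem_chamber ht hc m] with ω hω
    refine propext ⟨?_, ?_⟩
    · rintro ⟨hE, hx, hT, hu⟩
      exact ⟨⟨hE, ⟨hx, hω hE⟩, fun i hi => ⟨hT i hi, timeVec_mem_Icc hE (hω hE) i⟩⟩, hu⟩
    · rintro ⟨⟨hE, ⟨hx, -⟩, hT⟩, hu⟩
      exact ⟨hE, hx, fun i hi => (hT i hi).1, hu⟩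
  have h1 := key univ MeasurableSet.univ
  simp only [mem_univ, true_and, measure_univ, mul_one] at h1
  rw [key A hA, h1, mul_comm]

/-- Given that the lower strip has `m` points, the values of these points are independent of their
times and of the points of the upper strip, and are distributed as uniform order statistics. -/
theorem measure_minVec_indep (hP : IsUnitPoissonQuadrant P μ) [IsProbabilityMeasure μ]
    {t c : ℝ} (ht : 0 ≤ t) (hc : 0 < c) {m : ℕ} {A : Set (Fin m → ℝ)} (hA : MeasurableSet A)
    {V : Set Ω} (hV : MeasurableSet[MeasurableSpace.comap
      (fun ω => (timeVec (P ω) m t, countProcess P (upperStrip t c) ω)) inferInstance] V) :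
    μ (lowerEvent P m t c ∩ (fun ω => minVec (P ω) m t) ⁻¹' A ∩ V)
      = uniformOrderStatLaw m c A * μ (lowerEvent P m t c ∩ V) := by
  obtain ⟨W, hW, rfl⟩ := hV
  have hX := hP.measurable_minVec m t
  have hT := hP.measurable_timeVec m t
  have hU := hP.measurable_countProcess (upperStrip t c)
  have hF := hT.prodMk hU
  have hEm := hP.measurableSet_lowerEvent m t c
  set F := fun ω => (timeVec (P ω) m t, countProcess P (upperStrip t c) ω)
  -- Two extensions: from boxes of times to all Borel sets of times for a fixed upper event, then
  -- from rectangles to all measurable sets of pairs.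
  have h1 : (μ.restrict (lowerEvent P m t c ∩ (fun ω => minVec (P ω) m t) ⁻¹' A)).map F
      = uniformOrderStatLaw m c A • (μ.restrict (lowerEvent P m t c)).map F := by
    refine Measure.ext_prod fun {s u} hs hu => ?_
    have h2 : ∀ (E : Set Ω) (s : Set (Fin m → ℝ)), MeasurableSet s →
        (μ.restrict E).map F (s ×ˢ u)
          = (μ.restrict (E ∩ countProcess P (upperStrip t c) ⁻¹' u)).map
            (fun ω => timeVec (P ω) m t) s := by
      intro E s hs
      rw [Measure.map_apply hF (hs.prod hu), Measure.map_apply hT hs,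
        Measure.restrict_apply (hF (hs.prod hu)), Measure.restrict_apply (hT hs)]
      congr 1
      ext ω
      simp only [F, mem_inter_iff, mem_preimage, mem_prod]
      tauto
    have h3 : (μ.restrict (lowerEvent P m t c ∩ (fun ω => minVec (P ω) m t) ⁻¹' A ∩
          countProcess P (upperStrip t c) ⁻¹' u)).map (fun ω => timeVec (P ω) m t)
        = uniformOrderStatLaw m c A • (μ.restrict (lowerEvent P m t c ∩
          countProcess P (upperStrip t c) ⁻¹' u)).map (fun ω => timeVec (P ω) m t) := by
      have hbox : ∀ I : Fin m → Set ℝ, (∀ i, MeasurableSet (I i)) →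
          (μ.restrict (lowerEvent P m t c ∩ (fun ω => minVec (P ω) m t) ⁻¹' A ∩
          countProcess P (upperStrip t c) ⁻¹' u)).map (fun ω => timeVec (P ω) m t) (univ.pi I)
        = (uniformOrderStatLaw m c A • (μ.restrict (lowerEvent P m t c ∩
          countProcess P (upperStrip t c) ⁻¹' u)).map (fun ω => timeVec (P ω) m t))
            (univ.pi I) := by
        intro I hI
        have hIm := MeasurableSet.univ_pi hI
        rw [Measure.smul_apply, smul_eq_mul, Measure.map_apply hT hIm, Measure.map_apply hT hIm,
          Measure.restrict_apply (hT hIm), Measure.restrict_apply (hT hIm)]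
        convert hP.measure_minVec_timeVec ht hc hI hu hA using 2
        · ext ω
          simp only [mem_inter_iff, mem_preimage, mem_ofPred_eq]
          tauto
        · congr 1
          ext ω
          simp only [mem_inter_iff, mem_preimage, mem_ofPred_eq]
          tauto
      refine ext_of_generate_finite _ generateFrom_pi.symm isPiSystem_pi ?_ ?_
      · rintro _ ⟨I, hI, rfl⟩
        exact hbox I fun i => hI i (mem_univ i)
      · rw [← pi_univ univ]
        exact hbox _ fun _ => MeasurableSet.univ
    rw [h2 _ s hs, h3, Measure.smul_apply, Measure.smul_apply, h2 _ s hs]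
  have h4 := congrArg (fun ν => ν W) h1
  simp only [Measure.smul_apply, smul_eq_mul, Measure.map_apply hF hW,
    Measure.restrict_apply (hF hW)] at h4
  rw [inter_comm (F ⁻¹' W), inter_comm (F ⁻¹' W)] at h4
  exact h4

end IsUnitPoissonQuadrant

/-! ### The path and the records as functions of times and upper points -/

/-- The right side consists of the sets that agree on E with a set of m'. It is a σ-algebra, so
inclusions into it need checking only on generators. -/
theorem comap_le_of_eqOn {Ω β : Type*} {m' : MeasurableSpace Ω} {mβ : MeasurableSpace β}
    {E : Set Ω} {f f' : Ω → β} (hf' : Measurable f') (h : EqOn f f' E) :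
    MeasurableSpace.comap f mβ ≤
      MeasurableSpace.map (Subtype.val : E → Ω) (MeasurableSpace.comap Subtype.val m') := by
  rintro _ ⟨B, hB, rfl⟩
  refine ⟨f' ⁻¹' B, hf' hB, ?_⟩
  ext ω
  simp only [mem_preimage]
  rw [h ω.2]

namespace IsUnitPoissonQuadrant

/-- The σ-algebra generated by the times of the `m` lowest points and by the points of the upper
strip. -/
@[reducible] noncomputable def timeSigma {Ω : Type*} (P : Ω → Set (ℝ × ℝ)) (m : ℕ) (t c : ℝ) :
    MeasurableSpace Ω :=
  MeasurableSpace.comap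
    (fun ω => (timeVec (P ω) m t, countProcess P (upperStrip t c) ω)) inferInstance

theorem measurable_timeVec_timeSigma {Ω : Type*} (P : Ω → Set (ℝ × ℝ)) (m : ℕ) (t c : ℝ) :
    Measurable[timeSigma P m t c] fun ω => timeVec (P ω) m t :=
  measurable_fst.comp (comap_measurable _)

theorem measurable_count_timeSigma {Ω : Type*} (P : Ω → Set (ℝ × ℝ)) (m : ℕ) (t c : ℝ)
    {D : Set (ℝ × ℝ)} (hD : MeasurableSet D) (hDU : D ⊆ upperStrip t c) :
    Measurable[timeSigma P m t c] fun ω => (P ω ∩ D).encard :=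
  (((measurable_pi_apply (X := fun _ => ℕ∞) (⟨D, hD, hDU⟩ : {C : Set (ℝ × ℝ) // MeasurableSet C ∧
    C ⊆ upperStrip t c})).comp measurable_snd).comp (comap_measurable
    fun ω => (timeVec (P ω) m t, countProcess P (upperStrip t c) ω)) :)

/-- The respaced configuration does not see the original heights below c. With Ω carrying the
smaller σ-algebra `timeSigma`, the general measurability results for minima and record times apply
to it. -/
theorem isMeasurableConfig_respaced {Ω : Type*} {P : Ω → Set (ℝ × ℝ)}
    (hP : ∀ ω, ∀ K : Set (ℝ × ℝ), IsCompact K → (P ω ∩ K).Finite) (m : ℕ) (t c : ℝ) :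
    @IsMeasurableConfig Ω (timeSigma P m t c) fun ω => respaced (P ω) m t c := by
  refine @IsMeasurableConfig.mk Ω (timeSigma P m t c) _ (fun ω K hK => ?_) fun B hB => ?_
  · rw [respaced, union_inter_distrib_right]
    refine ((finite_range _).inter_of_left _).union ((hP ω K hK).subset ?_)
    exact inter_subset_inter_left _ inter_subset_left
  · refine @measurable_encard_of_hits Ω _ (timeSigma P m t c) _ _ _ _ _ _ (fun C hC => ?_) B hB
    have h1 : {ω | (respaced (P ω) m t c ∩ C).Nonempty}
        = (⋃ i : Fin m, {ω | (timeVec (P ω) m t i, c * i / m) ∈ C}) ∪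
          {ω | (P ω ∩ (upperStrip t c ∩ C)).encard ∈ ({0}ᶜ : Set ℕ∞)} := by
      ext ω
      simp only [respaced, union_inter_distrib_right, union_nonempty, mem_ofPred_eq, mem_union,
        mem_iUnion, mem_compl_iff, mem_singleton_iff, encard_eq_zero, inter_assoc,
        nonempty_iff_ne_empty.symm]
      refine or_congr ⟨?_, ?_⟩ Iff.rfl
      · rintro ⟨_, ⟨i, rfl⟩, hi⟩
        exact ⟨i, hi⟩
      · rintro ⟨i, hi⟩
        exact ⟨_, ⟨i, rfl⟩, hi⟩
    rw [h1]
    refine MeasurableSet.union (MeasurableSet.iUnion fun i => ?_)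
      (measurable_count_timeSigma P m t c ((measurableSet_upperStrip t c).inter hC)
        inter_subset_left (measurableSet_singleton 0).compl)
    have h2 : Measurable[timeSigma P m t c] fun ω => (timeVec (P ω) m t i, c * i / m) :=
      ((measurable_pi_apply i).comp (measurable_timeVec_timeSigma P m t c)).prodMk
        measurable_const
    exact h2 hC

/-- On the event considered, all generators of the path and record σ-algebras are unchanged by
respacing. -/
theorem exists_timeSigma_eq {Ω : Type*} {P : Ω → Set (ℝ × ℝ)} (hq : ∀ ω, P ω ⊆ quadrant)
    (hP : ∀ ω, ∀ K : Set (ℝ × ℝ), IsCompact K → (P ω ∩ K).Finite) {m : ℕ} {t c : ℝ} (hc : 0 < c)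
    {H : Set Ω} (hH : MeasurableSet[pathSigma P (m + 1) t ⊔ recordSigma P t] H) :
    ∃ H', MeasurableSet[timeSigma P m t c] H' ∧
      ∀ ω ∈ lowerEvent P m t c, minVec (P ω) m t ∈ chamber m → (ω ∈ H ↔ ω ∈ H') := by
  have hR := isMeasurableConfig_respaced hP m t c
  set E : Set Ω := {ω | ω ∈ lowerEvent P m t c ∧ minVec (P ω) m t ∈ chamber m}
  have hle : pathSigma P (m + 1) t ⊔ recordSigma P t ≤
      MeasurableSpace.map (Subtype.val : E → Ω)
        (MeasurableSpace.comap Subtype.val (timeSigma P m t c)) := by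
    refine sup_le (iSup₂_le fun s hs => ?_) (iSup₂_le fun j hj => iSup₂_le fun B hB => ?_)
    · refine comap_le_of_eqOn
        (@IsMeasurableConfig.measurable_kthMin Ω (timeSigma P m t c) _ hR (m + 1) (by omega) s)
        fun ω hω => (kthMin_respaced (hq ω) hc hω.1 hω.2 hs.2).symm
    · refine comap_le_of_eqOn (@IsMeasurableConfig.measurable_encard_recordTimes Ω
        (timeSigma P m t c) _ hR j t B hB) fun ω hω => ?_
      simp only [recordTimes_respaced (hq ω) hc hω.1 hω.2]
  obtain ⟨H', hH', heq⟩ := hle H hH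
  refine ⟨H', hH', fun ω h1 h2 => ?_⟩
  have : (⟨ω, h1, h2⟩ : E) ∈ (Subtype.val : E → Ω) ⁻¹' H' ↔
      (⟨ω, h1, h2⟩ : E) ∈ (Subtype.val : E → Ω) ⁻¹' H := by rw [heq]
  exact this.symm

variable {Ω : Type*} [mΩ : MeasurableSpace Ω] {μ : Measure Ω} {P : Ω → Set (ℝ × ℝ)}

/-- The set D, later a dyadic strip just above c, locates the next minimum without disturbing
independence, since hitting D is an event of the upper points. -/
theorem measure_minVec_indep_path_record (hP : IsUnitPoissonQuadrant P μ) [IsProbabilityMeasure μ]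
    {t c : ℝ} (ht : 0 ≤ t) (hc : 0 < c) {m : ℕ} {A : Set (Fin m → ℝ)} (hA : MeasurableSet A)
    {H : Set Ω} (hH : MeasurableSet[pathSigma P (m + 1) t ⊔ recordSigma P t] H)
    {D : Set (ℝ × ℝ)} (hD : MeasurableSet D) (hDU : D ⊆ upperStrip t c) :
    μ (lowerEvent P m t c ∩ (fun ω => minVec (P ω) m t) ⁻¹' A ∩
        (H ∩ {ω | (P ω ∩ D).Nonempty}))
      = uniformOrderStatLaw m c A *
        μ (lowerEvent P m t c ∩ (H ∩ {ω | (P ω ∩ D).Nonempty})) := by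
  obtain ⟨H', hH', heq⟩ := exists_timeSigma_eq hP.subset_quadrant hP.locallyFinite hc hH
  have hD' : MeasurableSet[timeSigma P m t c] {ω | (P ω ∩ D).Nonempty} := by
    have h := measurable_count_timeSigma P m t c hD hDU (measurableSet_singleton 0).compl
    convert h using 1
    ext ω
    simp only [mem_preimage, mem_compl_iff, mem_singleton_iff, encard_eq_zero, mem_ofPred_eq,
      nonempty_iff_ne_empty]
  have hae := hP.ae_minVec_mem_chamber ht hc m
  have h1 : μ (lowerEvent P m t c ∩ (fun ω => minVec (P ω) m t) ⁻¹' A ∩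
        (H ∩ {ω | (P ω ∩ D).Nonempty})) = μ (lowerEvent P m t c ∩
        (fun ω => minVec (P ω) m t) ⁻¹' A ∩ (H' ∩ {ω | (P ω ∩ D).Nonempty})) := by
    refine measure_congr ?_
    filter_upwards [hae] with ω hω
    refine propext ⟨?_, ?_⟩
    · rintro ⟨⟨h1, h2⟩, h3, h4⟩
      exact ⟨⟨h1, h2⟩, (heq ω h1 (hω h1)).1 h3, h4⟩
    · rintro ⟨⟨h1, h2⟩, h3, h4⟩
      exact ⟨⟨h1, h2⟩, (heq ω h1 (hω h1)).2 h3, h4⟩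
  have h2 : μ (lowerEvent P m t c ∩ (H ∩ {ω | (P ω ∩ D).Nonempty}))
      = μ (lowerEvent P m t c ∩ (H' ∩ {ω | (P ω ∩ D).Nonempty})) := by
    refine measure_congr ?_
    filter_upwards [hae] with ω hω
    refine propext ⟨?_, ?_⟩
    · rintro ⟨h1, h3, h4⟩
      exact ⟨h1, (heq ω h1 (hω h1)).1 h3, h4⟩
    · rintro ⟨h1, h3, h4⟩
      exact ⟨h1, (heq ω h1 (hω h1)).2 h3, h4⟩
  rw [h1, h2]
  exact hP.measure_minVec_indep ht hc hA (hH'.inter hD')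

end IsUnitPoissonQuadrant

/-! ### Continuity in the level and dyadic approximation -/

/-- The law of the order statistics of uniform variables on `[0, 1]`, scaled by `x`. -/
noncomputable def scaledOrderStatLaw (n : ℕ) (x : ℝ) : Measure (Fin n → ℝ) :=
  (uniformOrderStatLaw n 1).map (x • ·)

instance (n : ℕ) : IsProbabilityMeasure (uniformOrderStatLaw n 1) :=
  isProbabilityMeasure_uniformOrderStatLaw n one_pos

instance (n : ℕ) (x : ℝ) : IsProbabilityMeasure (scaledOrderStatLaw n x) :=
  Measure.isProbabilityMeasure_map (measurable_const_smul x).aemeasurable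

theorem measurable_scaledOrderStatLaw (n : ℕ) : Measurable (scaledOrderStatLaw n) := by
  refine Measure.measurable_of_measurable_coe _ fun A hA => ?_
  have h : Measurable fun p : ℝ × (Fin n → ℝ) => p.1 • p.2 := by fun_prop
  have h1 := measurable_measure_prodMk_left (ν := uniformOrderStatLaw n 1) (h hA)
  convert h1 using 2 with x
  rw [scaledOrderStatLaw, Measure.map_apply (measurable_const_smul x) hA]
  rfl

open Filter Topology in
theorem tendsto_lintegral_scaledOrderStatLaw {n : ℕ}
    (f : BoundedContinuousFunction (Fin n → ℝ) NNReal) {y : ℕ → ℝ} {x : ℝ}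
    (hy : Tendsto y atTop (𝓝 x)) :
    Tendsto (fun i => ∫⁻ u, f u ∂(scaledOrderStatLaw n (y i))) atTop
      (𝓝 (∫⁻ u, f u ∂(scaledOrderStatLaw n x))) := by
  have hm : Measurable fun u => (f u : ENNReal) := by fun_prop
  simp only [scaledOrderStatLaw, lintegral_map hm (measurable_const_smul _)]
  refine tendsto_lintegral_of_dominated_convergence (fun _ => (nndist f 0 : ENNReal))
    (fun i => hm.comp (measurable_const_smul _)) (fun i => Eventually.of_forall fun u => ?_)
    (by simp) (Eventually.of_forall fun u => ?_)
  · exact ENNReal.coe_le_coe.2 (BoundedContinuousFunction.NNReal.upper_bound f _)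
  · refine ENNReal.tendsto_coe.2 ((f.continuous.tendsto _).comp ?_)
    exact hy.smul tendsto_const_nhds

namespace IsUnitPoissonQuadrant

section Levels

/-- The dyadic level `(i + 1) / 2 ^ n`. -/
noncomputable def dyadicLevel (n i : ℕ) : ℝ := ((i : ℝ) + 1) / 2 ^ n

theorem dyadicLevel_pos (n i : ℕ) : 0 < dyadicLevel n i := by
  unfold dyadicLevel; positivity

/-- The points observed by time `t` with value in a dyadic interval. -/
def dyadicStrip (t : ℝ) (n i : ℕ) : Set (ℝ × ℝ) :=
  Icc 0 t ×ˢ Ico (dyadicLevel n i) (dyadicLevel n (i + 1))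

theorem measurableSet_dyadicStrip (t : ℝ) (n i : ℕ) : MeasurableSet (dyadicStrip t n i) :=
  measurableSet_Icc.prod measurableSet_Ico

theorem dyadicStrip_subset (t : ℝ) (n i : ℕ) :
    dyadicStrip t n i ⊆ upperStrip t (dyadicLevel n i) :=
  prod_mono_right Ico_subset_Ici_self

variable {S : Set (ℝ × ℝ)} {m : ℕ} {t : ℝ}

/-- A point of the dyadic strip together with the m lower ones makes m + 1, while below the strip
there are too few. -/
theorem kthMin_mem_dyadic {n i : ℕ} (hS : S ⊆ quadrant)
    (h : (S ∩ lowerStrip t (dyadicLevel n i)).encard = m)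
    (hne : (S ∩ dyadicStrip t n i).Nonempty) :
    kthMin S (m + 1) t ∈ Ico (dyadicLevel n i) (dyadicLevel n (i + 1)) := by
  obtain ⟨a, ha, hat, hac, had⟩ := hne
  have hmem : a.2 ∈ countLevels S (m + 1) t := by
    have h1 : (insert a (S ∩ lowerStrip t (dyadicLevel n i))).encard = ((m + 1 : ℕ) : ℕ∞) := by
      rw [encard_insert_of_notMem, h]
      · rfl
      · exact fun hmem => absurd hmem.2.2.2 (not_lt.2 hac)
    refine h1.symm.le.trans (encard_le_encard ?_)
    rintro b (rfl | hb)
    · exact ⟨ha, hat, (hS ha).2, le_rfl⟩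
    · exact ⟨hb.1, hb.2.1, hb.2.2.1, (hb.2.2.2.trans_le hac).le⟩
  constructor
  · refine le_csInf ⟨_, hmem⟩ fun x hx => ?_
    by_contra hlt
    have : ((m + 1 : ℕ) : ℕ∞) ≤ (m : ℕ) := by
      refine le_trans hx (le_trans (encard_le_encard ?_) h.le)
      intro b hb
      exact ⟨hb.1, hb.2.1, hb.2.2.1, hb.2.2.2.trans_lt (not_le.1 hlt)⟩
    have : m + 1 ≤ m := by exact_mod_cast this
    omega
  · exact lt_of_le_of_lt (csInf_le ⟨0, fun _ hz => countLevels_nonneg (by omega) hz⟩ hmem) had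

/-- The dyadic approximation from below. -/
noncomputable def dyadicFloor (n : ℕ) (x : ℝ) : ℝ := (⌊x * 2 ^ n⌋₊ : ℝ) / 2 ^ n

theorem dyadicFloor_eq {n i : ℕ} {x : ℝ}
    (h : x ∈ Ico (dyadicLevel n i) (dyadicLevel n (i + 1))) :
    dyadicFloor n x = dyadicLevel n i := by
  have h2 : (0 : ℝ) < 2 ^ n := by positivity
  have h1 : ⌊x * 2 ^ n⌋₊ = i + 1 := by
    rw [Nat.floor_eq_iff' (by omega)]
    simp only [dyadicLevel, mem_Ico, div_le_iff₀ h2, lt_div_iff₀ h2] at h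
    push_cast at h ⊢
    exact h
  rw [dyadicFloor, h1, dyadicLevel]
  push_cast
  rfl

theorem measurable_dyadicFloor (n : ℕ) : Measurable (dyadicFloor n) := by
  unfold dyadicFloor
  fun_prop

open Filter Topology in
theorem tendsto_dyadicFloor {x : ℝ} (hx : 0 ≤ x) :
    Tendsto (fun n => dyadicFloor n x) atTop (𝓝 x) :=
  (tendsto_nat_floor_mul_div_atTop hx).comp
    (tendsto_pow_atTop_atTop_of_one_lt (one_lt_two : (1 : ℝ) < 2))

open Filter Topology in
-- Only finitely many points lie strictly below the (m + 1)-th minimum, so its dyadic roundings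
-- eventually exceed all their heights. The atom attaining the minimum lies in the strip above.
theorem eventually_exists_dyadic (hS : ∀ K, IsCompact K → (S ∩ K).Finite)
    (hne : (countLevels S (m + 1) t).Nonempty) (hpos : 0 < kthMin S (m + 1) t)
    (hcount : (S ∩ lowerStrip t (kthMin S (m + 1) t)).encard = m) :
    ∀ᶠ n in atTop, ∃ i, (S ∩ lowerStrip t (dyadicLevel n i)).encard = m ∧
      (S ∩ dyadicStrip t n i).Nonempty := by
  obtain ⟨x, hx⟩ := hne
  obtain ⟨-, a, ha, hat, ha2, -⟩ := kthMin_attained hS (by omega) hx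
  set Z := kthMin S (m + 1) t
  have hlim := tendsto_dyadicFloor hpos.le
  have hfin := lowerStrip_finite hS t Z
  have h1 : ∀ᶠ n in atTop, ∀ b ∈ S ∩ lowerStrip t Z, b.2 < dyadicFloor n Z :=
    (eventually_all_finite hfin).2 fun b hb => hlim.eventually_const_lt hb.2.2.2
  filter_upwards [h1, hlim.eventually_const_lt hpos] with n hn hn0
  have h2 : (0 : ℝ) < 2 ^ n := by positivity
  have hfl : 0 < ⌊Z * 2 ^ n⌋₊ := by
    rcases Nat.eq_zero_or_pos ⌊Z * 2 ^ n⌋₊ with h | h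
    · simp [dyadicFloor, h] at hn0
    · exact h
  obtain ⟨i, hi⟩ : ∃ i, ⌊Z * 2 ^ n⌋₊ = i + 1 := ⟨_, (Nat.sub_add_cancel hfl).symm⟩
  have hZ : Z ∈ Ico (dyadicLevel n i) (dyadicLevel n (i + 1)) := by
    rw [Nat.floor_eq_iff' (by omega)] at hi
    simp only [dyadicLevel, mem_Ico, div_le_iff₀ h2, lt_div_iff₀ h2]
    push_cast at hi ⊢
    exact hi
  rw [dyadicFloor_eq hZ] at hn
  refine ⟨i, ?_, a, ha, hat, ha2 ▸ hZ⟩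
  rw [← hcount]
  congr 1
  ext b
  constructor
  · exact fun hb => ⟨hb.1, hb.2.1, hb.2.2.1, hb.2.2.2.trans_le hZ.1⟩
  · exact fun hb => ⟨hb.1, hb.2.1, hb.2.2.1, hn b hb⟩

/-- Distinctness of heights is assumed at integer levels only, so that countably many almost sure
statements suffice; some integer exceeds the minimum. -/
theorem encard_lowerStrip_kthMin (hS : ∀ K, IsCompact K → (S ∩ K).Finite)
    (hne : (countLevels S (m + 1) t).Nonempty)
    (h : ∀ (N : ℕ) (M : ℕ), 1 ≤ N → (S ∩ lowerStrip t N).encard = M → minVec S M t ∈ chamber M) :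
    (S ∩ lowerStrip t (kthMin S (m + 1) t)).encard = m := by
  obtain ⟨x, hx⟩ := hne
  obtain ⟨hlev, -⟩ := kthMin_attained hS (by omega) hx
  obtain ⟨N, hN⟩ := exists_nat_gt (max 1 (kthMin S (m + 1) t))
  have hN1 : 1 ≤ N := by
    have : (1 : ℝ) < N := (le_max_left _ _).trans_lt hN
    exact_mod_cast this.le
  have hNZ : kthMin S (m + 1) t < N := (le_max_right _ _).trans_lt hN
  obtain ⟨M, hM⟩ : ∃ M : ℕ, (S ∩ lowerStrip t N).encard = M :=
    ⟨_, ((lowerStrip_finite hS t N).cast_ncard_eq).symm⟩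
  have hX := h N M hN1 hM
  obtain ⟨b, hb, hr, hm⟩ := exists_enum hM
  have hXb := minVec_eq_of_enum hb hr hm
  have hs : StrictMono fun i => (b i).2 := fun i j hij => by
    have := hX hij
    rwa [hXb, hXb] at this
  have hbm : ∀ j, b j ∈ S ∩ lowerStrip t N := fun j => hr ▸ mem_range_self j
  have hmM : m < M := by
    have : ((m + 1 : ℕ) : ℕ∞) ≤ M := by
      refine le_trans hlev (le_trans (encard_le_encard ?_) hM.le)
      intro a ha
      exact ⟨ha.1, ha.2.1, ha.2.2.1, ha.2.2.2.trans_lt hNZ⟩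
    have : m + 1 ≤ M := by exact_mod_cast this
    omega
  have hZ : kthMin S (m + 1) t = (b ⟨m, hmM⟩).2 := hXb ⟨m, hmM⟩
  have : S ∩ lowerStrip t (kthMin S (m + 1) t) = b '' Iio ⟨m, hmM⟩ := by
    ext a
    constructor
    · intro ha
      have : a ∈ range b := by
        rw [hr]
        exact ⟨ha.1, ha.2.1, ha.2.2.1, ha.2.2.2.trans hNZ⟩
      obtain ⟨j, rfl⟩ := this
      have hj : (b j).2 < kthMin S (m + 1) t := ha.2.2.2
      rw [hZ] at hj
      exact ⟨j, hs.lt_iff_lt.1 hj, rfl⟩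
    · rintro ⟨j, hj, rfl⟩
      refine ⟨(hbm j).1, (hbm j).2.1, (hbm j).2.2.1, ?_⟩
      rw [hZ]
      exact hs hj
  rw [this, hb.encard_image, ← Finset.coe_Iio, encard_coe_eq_coe_finsetCard, Fin.card_Iio]

end Levels

variable {Ω : Type*} [mΩ : MeasurableSpace Ω] {μ : Measure Ω} {P : Ω → Set (ℝ × ℝ)}

open Filter Topology in
-- For every N the failure probability is at most that of fewer than k points in a strip of area tN,
-- which tends to 0.
theorem ae_countLevels_nonempty (hP : IsUnitPoissonQuadrant P μ) {t : ℝ} (ht : 0 < t) (k : ℕ) :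
    ∀ᵐ ω ∂μ, (countLevels (P ω) k t).Nonempty := by
  have hbound : ∀ N : ℕ, μ {ω | ¬ (countLevels (P ω) k t).Nonempty} ≤
      ∑ j ∈ Finset.range k, ENNReal.ofReal (Real.exp (-(t * N)) * (t * N) ^ j / j.factorial) := by
    intro N
    have hv : volume.real (lowerStrip t N) = t * N := by
      rw [measureReal_def, volume_lowerStrip, ENNReal.toReal_mul, ENNReal.toReal_ofReal ht.le,
        ENNReal.toReal_ofReal N.cast_nonneg]
    have hsub : {ω | ¬ (countLevels (P ω) k t).Nonempty} ⊆
        ⋃ j ∈ Finset.range k, {ω | (P ω ∩ lowerStrip t N).encard = j} := by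
      intro ω hω
      obtain ⟨j, hj⟩ : ∃ j : ℕ, (P ω ∩ lowerStrip t N).encard = j :=
        ⟨_, ((lowerStrip_finite (hP.locallyFinite ω) t N).cast_ncard_eq).symm⟩
      refine mem_iUnion₂.2 ⟨j, ?_, hj⟩
      by_contra hjk
      rw [Finset.mem_range, not_lt] at hjk
      refine hω ⟨N, le_trans (by exact_mod_cast hjk) (hj.symm.le.trans (encard_le_encard ?_))⟩
      exact inter_subset_inter_right _ (prod_mono_right Ico_subset_Icc_self)
    refine (measure_mono hsub).trans ((measure_biUnion_finset_le _ _).trans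
      (Finset.sum_le_sum fun j _ => le_of_eq ?_))
    rw [hP.measure_count_eq (measurableSet_lowerStrip t N) (lowerStrip_subset_quadrant t N)
      (by rw [volume_lowerStrip]
          exact ENNReal.mul_ne_top ENNReal.ofReal_ne_top ENNReal.ofReal_ne_top), hv]
  have hlim : Tendsto (fun N : ℕ => ∑ j ∈ Finset.range k,
      ENNReal.ofReal (Real.exp (-(t * N)) * (t * N) ^ j / j.factorial)) atTop (𝓝 0) := by
    rw [← Finset.sum_const_zero (s := Finset.range k)]
    refine tendsto_finsetSum _ fun j _ => ?_
    rw [← ENNReal.ofReal_zero]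
    refine ENNReal.tendsto_ofReal ?_
    have h1 : Tendsto (fun N : ℕ => t * (N : ℝ)) atTop atTop :=
      tendsto_natCast_atTop_atTop.const_mul_atTop ht
    have h2 := ((Real.tendsto_pow_mul_exp_neg_atTop_nhds_zero j).comp h1).div_const
      (j.factorial : ℝ)
    rw [zero_div] at h2
    refine h2.congr fun N => ?_
    simp only [Function.comp]
    ring
  exact le_antisymm (ge_of_tendsto hlim (Eventually.of_forall hbound)) zero_le

/-- The minimum is almost surely the height of an atom, and the segment at height 0 is null. -/
theorem ae_kthMin_pos (hP : IsUnitPoissonQuadrant P μ) [IsProbabilityMeasure μ] {t : ℝ}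
    (ht : 0 < t) {k : ℕ} (hk : 1 ≤ k) : ∀ᵐ ω ∂μ, 0 < kthMin (P ω) k t := by
  have hvol : volume (Icc 0 t ×ˢ ({0} : Set ℝ)) = 0 := by
    rw [Measure.volume_eq_prod, Measure.prod_prod, Real.volume_singleton, mul_zero]
  have hm : MeasurableSet (Icc 0 t ×ˢ ({0} : Set ℝ)) :=
    measurableSet_Icc.prod (measurableSet_singleton _)
  have h1 := hP.measure_count_eq hm
    (prod_mono Icc_subset_Ici_self (singleton_subset_iff.2 self_mem_Ici)) (by simp [hvol]) 0
  rw [measureReal_def, hvol] at h1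
  simp only [ENNReal.toReal_zero, neg_zero, Real.exp_zero, pow_zero, mul_one, Nat.factorial_zero,
    Nat.cast_one, div_one, ENNReal.ofReal_one] at h1
  have h2 : ∀ᵐ ω ∂μ, (P ω ∩ Icc 0 t ×ˢ ({0} : Set ℝ)).encard = (0 : ℕ) :=
    (prob_compl_eq_zero_iff (hP.measurable_count _ hm (measurableSet_singleton ((0 : ℕ) : ℕ∞)))).2
      h1
  filter_upwards [h2, hP.ae_countLevels_nonempty ht k] with ω h0 ⟨x, hx⟩
  obtain ⟨-, a, ha, hat, ha2, ha0⟩ := kthMin_attained (hP.locallyFinite ω) hk hx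
  rw [← ha2]
  refine lt_of_le_of_ne ha0 fun h => ?_
  rw [Nat.cast_zero, encard_eq_zero, eq_empty_iff_forall_notMem] at h0
  exact h0 a ⟨ha, hat, h.symm⟩

theorem ae_encard_lowerStrip_kthMin (hP : IsUnitPoissonQuadrant P μ) [IsProbabilityMeasure μ]
    {t : ℝ} (ht : 0 < t) (m : ℕ) :
    ∀ᵐ ω ∂μ, (P ω ∩ lowerStrip t (kthMin (P ω) (m + 1) t)).encard = m := by
  have h1 : ∀ᵐ ω ∂μ, ∀ N M : ℕ, 1 ≤ N → (P ω ∩ lowerStrip t N).encard = M →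
      minVec (P ω) M t ∈ chamber M := by
    refine ae_all_iff.2 fun N => ae_all_iff.2 fun M => ?_
    by_cases hN : 1 ≤ N
    · filter_upwards [hP.ae_minVec_mem_chamber ht.le (c := N) (by exact_mod_cast hN) M]
        with ω hω _ h using hω h
    · exact Filter.Eventually.of_forall fun ω h => absurd h hN
  filter_upwards [h1, hP.ae_countLevels_nonempty ht (m + 1)] with ω h hne
  exact encard_lowerStrip_kthMin (hP.locallyFinite ω) hne h

end IsUnitPoissonQuadrant

/-! ### From fixed levels to the conditional law -/

/-- Conditional independence follows if the conditional probabilities of the first σ-algebra do not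
change when the second σ-algebra is added to the condition. -/
theorem condIndepSigma_of_condExp_sup {Ω : Type*} {m' m₁ m₂ : MeasurableSpace Ω}
    [mΩ : MeasurableSpace Ω] {μ : Measure Ω} [IsProbabilityMeasure μ] (hm' : m' ≤ mΩ) (hm₁ : m₁ ≤ mΩ) (hm₂ : m₂ ≤ mΩ)
    (h : ∀ A, MeasurableSet[m₁] A → μ⟦A | m' ⊔ m₂⟧ =ᵐ[μ] μ⟦A | m'⟧) :
    CondIndepSigma m' m₁ m₂ μ := by
  intro A F hA hF
  have hs : m' ⊔ m₂ ≤ mΩ := sup_le hm' hm₂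
  have hFs : MeasurableSet[m' ⊔ m₂] F := (le_sup_right : m₂ ≤ m' ⊔ m₂) F hF
  have hAi : Integrable (A.indicator fun _ => (1 : ℝ)) μ :=
    (integrable_const 1).indicator (hm₁ A hA)
  have hFi : Integrable (F.indicator fun _ => (1 : ℝ)) μ :=
    (integrable_const 1).indicator (hm₂ F hF)
  -- F is known under the larger condition and is pulled out; the tower property then brings the
  -- condition back to m'.
  have h1 : μ⟦A ∩ F | m' ⊔ m₂⟧ =ᵐ[μ] F.indicator (μ⟦A | m'⟧) := by
    have he : (A ∩ F).indicator (fun _ => (1 : ℝ)) = F.indicator (A.indicator fun _ => 1) := by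
      rw [indicator_indicator, inter_comm]
    rw [he]
    refine (condExp_indicator hAi hFs).trans ?_
    filter_upwards [h A hA] with ω hω
    by_cases hωF : ω ∈ F <;> simp [hωF, hω]
  have h2 : F.indicator (μ⟦A | m'⟧) = (μ⟦A | m'⟧) * F.indicator fun _ => (1 : ℝ) := by
    ext ω
    by_cases hωF : ω ∈ F <;> simp [hωF]
  have h3 : Integrable ((μ⟦A | m'⟧) * F.indicator fun _ => (1 : ℝ)) μ := by
    rw [← h2]
    exact integrable_condExp.indicator (hm₂ F hF)
  calc μ⟦A ∩ F | m'⟧ =ᵐ[μ] μ[μ⟦A ∩ F | m' ⊔ m₂⟧ | m'] :=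
        (condExp_condExp_of_le le_sup_left hs).symm
    _ =ᵐ[μ] μ[(μ⟦A | m'⟧) * F.indicator fun _ => (1 : ℝ) | m'] := by
        rw [← h2]
        exact condExp_congr_ae h1
    _ =ᵐ[μ] μ⟦A | m'⟧ * μ⟦F | m'⟧ :=
        condExp_mul_of_stronglyMeasurable_left stronglyMeasurable_condExp h3 hFi

namespace IsUnitPoissonQuadrant

section

variable {Ω : Type*} [mΩ : MeasurableSpace Ω] {μ : Measure Ω} {P : Ω → Set (ℝ × ℝ)}

theorem pathSigma_le (hP : IsUnitPoissonQuadrant P μ) {k : ℕ} (hk : 1 ≤ k) (t : ℝ) :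
    pathSigma P k t ≤ mΩ :=
  iSup₂_le fun s _ => (hP.isMeasurableConfig.measurable_kthMin hk s).comap_le

theorem recordSigma_le (hP : IsUnitPoissonQuadrant P μ) (t : ℝ) : recordSigma P t ≤ mΩ :=
  iSup₂_le fun j _ => iSup₂_le fun _ hB =>
    (hP.isMeasurableConfig.measurable_encard_recordTimes j t hB).comap_le

/-- The event that the dyadic interval with index `i` separates the `m` lowest values from the next
one, which belongs to the interval. -/
def dyadicEvent (P : Ω → Set (ℝ × ℝ)) (m : ℕ) (t : ℝ) (n i : ℕ) : Set Ω :=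
  lowerEvent P m t (dyadicLevel n i) ∩ {ω | (P ω ∩ dyadicStrip t n i).Nonempty}

theorem measurableSet_dyadicEvent (hP : IsUnitPoissonQuadrant P μ) (m : ℕ) (t : ℝ) (n i : ℕ) :
    MeasurableSet (dyadicEvent P m t n i) := by
  refine (hP.measurableSet_lowerEvent m t _).inter ?_
  have h := hP.measurable_count _ (measurableSet_dyadicStrip t n i) (measurableSet_singleton 0).compl
  convert h using 1
  ext ω
  simp only [mem_preimage, mem_compl_iff, mem_singleton_iff, encard_eq_zero, mem_ofPred_eq,
    nonempty_iff_ne_empty]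

theorem dyadicFloor_kthMin (hP : IsUnitPoissonQuadrant P μ) {m : ℕ} {t : ℝ} {n i : ℕ} {ω : Ω}
    (h : ω ∈ dyadicEvent P m t n i) :
    dyadicFloor n (kthMin (P ω) (m + 1) t) = dyadicLevel n i :=
  dyadicFloor_eq (kthMin_mem_dyadic (hP.subset_quadrant ω) h.1 h.2)

theorem pairwise_disjoint_dyadicEvent (hP : IsUnitPoissonQuadrant P μ) (m : ℕ) (t : ℝ) (n : ℕ) :
    Pairwise fun i j => Disjoint (dyadicEvent P m t n i) (dyadicEvent P m t n j) := by
  intro i j hij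
  refine disjoint_left.2 fun ω hi hj => hij ?_
  have h := (hP.dyadicFloor_kthMin hi).symm.trans (hP.dyadicFloor_kthMin hj)
  have h2 : (0 : ℝ) < 2 ^ n := by positivity
  simp only [dyadicLevel] at h
  rw [div_left_inj' h2.ne', add_left_inj] at h
  exact_mod_cast h

/-- On this event the fixed level is the dyadic rounding of the minimum, so the integrand on the
right has the same form for every i and the identities can be summed. -/
theorem setLIntegral_dyadicEvent (hP : IsUnitPoissonQuadrant P μ) [IsProbabilityMeasure μ]
    {t : ℝ} (ht : 0 < t) {m : ℕ}
    {H : Set Ω} (hH : MeasurableSet[pathSigma P (m + 1) t ⊔ recordSigma P t] H)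
    {f : (Fin m → ℝ) → ENNReal} (hf : Measurable f) (n i : ℕ) :
    ∫⁻ ω in H ∩ dyadicEvent P m t n i, f (minVec (P ω) m t) ∂μ
      = ∫⁻ ω in H ∩ dyadicEvent P m t n i,
        (∫⁻ u, f u ∂(scaledOrderStatLaw m (dyadicFloor n (kthMin (P ω) (m + 1) t)))) ∂μ := by
  have hX := hP.measurable_minVec m t
  have hc := dyadicLevel_pos n i
  have hHm : MeasurableSet H :=
    sup_le (hP.pathSigma_le (by omega) t) (hP.recordSigma_le t) _ hH
  have hEm := hHm.inter (hP.measurableSet_dyadicEvent m t n i)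
  have h1 : (μ.restrict (H ∩ dyadicEvent P m t n i)).map (fun ω => minVec (P ω) m t)
      = μ (H ∩ dyadicEvent P m t n i) • scaledOrderStatLaw m (dyadicLevel n i) := by
    ext A hA
    have h := hP.measure_minVec_indep_path_record ht.le hc hA hH (measurableSet_dyadicStrip t n i)
      (dyadicStrip_subset t n i)
    rw [Measure.map_apply hX hA, Measure.restrict_apply (hX hA), Measure.smul_apply, smul_eq_mul,
      scaledOrderStatLaw, ← uniformOrderStatLaw_eq_map m hc, mul_comm]
    refine Eq.trans (congrArg μ ?_) (h.trans (congrArg (fun s => _ * μ s) ?_))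
    · ext ω
      simp only [dyadicEvent, mem_inter_iff]
      tauto
    · ext ω
      simp only [dyadicEvent, mem_inter_iff]
      tauto
  rw [← lintegral_map hf hX, h1, lintegral_smul_measure, smul_eq_mul]
  rw [setLIntegral_congr_fun (g := fun _ =>
      ∫⁻ u, f u ∂(scaledOrderStatLaw m (dyadicLevel n i))) hEm
    fun ω hω => by simp only [hP.dyadicFloor_kthMin hω.2], setLIntegral_const, mul_comm]

open Filter Topology in
-- Sum over the levels of mesh 2^(-n) and let n grow, by dominated convergence. Test functions are
-- continuous because the law is used as a weakly continuous function of the level.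
theorem setLIntegral_minVec (hP : IsUnitPoissonQuadrant P μ) [IsProbabilityMeasure μ]
    {t : ℝ} (ht : 0 < t) {m : ℕ}
    {H : Set Ω} (hH : MeasurableSet[pathSigma P (m + 1) t ⊔ recordSigma P t] H)
    (f : BoundedContinuousFunction (Fin m → ℝ) NNReal) :
    ∫⁻ ω in H, f (minVec (P ω) m t) ∂μ
      = ∫⁻ ω in H, (∫⁻ u, f u ∂(scaledOrderStatLaw m (kthMin (P ω) (m + 1) t))) ∂μ := by
  have hX := hP.measurable_minVec m t
  have hZ := hP.isMeasurableConfig.measurable_kthMin (k := m + 1) (by omega) t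
  have hf : Measurable fun u => (f u : ENNReal) := by fun_prop
  have hφ : Measurable fun x => ∫⁻ u, f u ∂(scaledOrderStatLaw m x) :=
    (Measure.measurable_lintegral hf).comp (measurable_scaledOrderStatLaw m)
  have hHm : MeasurableSet H :=
    sup_le (hP.pathSigma_le (by omega) t) (hP.recordSigma_le t) _ hH
  let D : ℕ → Set Ω := fun n => ⋃ i, dyadicEvent P m t n i
  have hDm : ∀ n, MeasurableSet (D n) := fun n =>
    MeasurableSet.iUnion fun i => hP.measurableSet_dyadicEvent m t n i
  have hsplit : ∀ n (g : Ω → ENNReal), ∫⁻ ω in H, (D n).indicator g ω ∂μ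
      = ∑' i, ∫⁻ ω in H ∩ dyadicEvent P m t n i, g ω ∂μ := by
    intro n g
    rw [setLIntegral_indicator (hDm n), inter_comm, inter_iUnion, lintegral_iUnion]
    · exact fun i => hHm.inter (hP.measurableSet_dyadicEvent m t n i)
    · exact fun i j hij => (hP.pairwise_disjoint_dyadicEvent m t n hij).mono
        inter_subset_right inter_subset_right
  have heq : ∀ n, ∫⁻ ω in H, (D n).indicator (fun ω => (f (minVec (P ω) m t) : ENNReal)) ω ∂μ
      = ∫⁻ ω in H, (D n).indicator (fun ω => ∫⁻ u, f u
        ∂(scaledOrderStatLaw m (dyadicFloor n (kthMin (P ω) (m + 1) t)))) ω ∂μ := by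
    intro n
    rw [hsplit, hsplit]
    exact tsum_congr fun i => hP.setLIntegral_dyadicEvent ht hH hf n i
  -- The dyadic events of order n need not cover Ω, but almost every ω is in their union for all
  -- large n.
  have hev : ∀ᵐ ω ∂(μ.restrict H), ∀ᶠ n in atTop, ω ∈ D n := by
    refine ae_restrict_of_ae ?_
    filter_upwards [hP.ae_countLevels_nonempty ht (m + 1), hP.ae_kthMin_pos ht (k := m + 1)
      (by omega), hP.ae_encard_lowerStrip_kthMin ht m] with ω h1 h2 h3
    filter_upwards [eventually_exists_dyadic (hP.locallyFinite ω) h1 h2 h3] with n ⟨i, hi⟩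
    exact mem_iUnion.2 ⟨i, hi⟩
  have hbound : ∀ x, ∫⁻ u, f u ∂(scaledOrderStatLaw m x) ≤ (nndist f 0 : ENNReal) := by
    intro x
    refine (lintegral_mono fun u => ENNReal.coe_le_coe.2
      (BoundedContinuousFunction.NNReal.upper_bound f u)).trans ?_
    simp
  have hl1 : Tendsto (fun n => ∫⁻ ω in H,
      (D n).indicator (fun ω => (f (minVec (P ω) m t) : ENNReal)) ω ∂μ) atTop
      (𝓝 (∫⁻ ω in H, f (minVec (P ω) m t) ∂μ)) := by
    refine tendsto_lintegral_of_dominated_convergence (fun _ => (nndist f 0 : ENNReal))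
      (fun n => (hf.comp hX).indicator (hDm n)) (fun n => Eventually.of_forall fun ω => ?_)
      (by simp [ENNReal.mul_eq_top]) ?_
    · exact (indicator_le_self' (fun _ _ => zero_le) ω).trans (ENNReal.coe_le_coe.2
        (BoundedContinuousFunction.NNReal.upper_bound f _))
    · filter_upwards [hev] with ω hω
      refine tendsto_const_nhds.congr' ?_
      filter_upwards [hω] with n hn
      rw [indicator_of_mem hn]
  have hl2 : Tendsto (fun n => ∫⁻ ω in H, (D n).indicator (fun ω => ∫⁻ u, f u
      ∂(scaledOrderStatLaw m (dyadicFloor n (kthMin (P ω) (m + 1) t)))) ω ∂μ) atTop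
      (𝓝 (∫⁻ ω in H, (∫⁻ u, f u ∂(scaledOrderStatLaw m (kthMin (P ω) (m + 1) t))) ∂μ)) := by
    refine tendsto_lintegral_of_dominated_convergence (fun _ => (nndist f 0 : ENNReal))
      (fun n => (hφ.comp ((measurable_dyadicFloor n).comp hZ)).indicator (hDm n))
      (fun n => Eventually.of_forall fun ω => ?_) (by simp [ENNReal.mul_eq_top]) ?_
    · exact (indicator_le_self' (fun _ _ => zero_le) ω).trans (hbound _)
    · filter_upwards [hev, ae_restrict_of_ae (hP.ae_kthMin_pos ht (k := m + 1) (by omega))]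
        with ω hω hpos
      refine (tendsto_lintegral_scaledOrderStatLaw f (tendsto_dyadicFloor hpos.le)).congr' ?_
      filter_upwards [hω] with n hn
      rw [indicator_of_mem hn]
  simp only [heq] at hl1
  exact tendsto_nhds_unique hl1 hl2

/-- The smaller minima have, given the path of the `(m + 1)`-th minimum and the record times, the
law of uniform order statistics. -/
theorem measure_inter_minVec (hP : IsUnitPoissonQuadrant P μ) [IsProbabilityMeasure μ]
    {t : ℝ} (ht : 0 < t) {m : ℕ}
    {H : Set Ω} (hH : MeasurableSet[pathSigma P (m + 1) t ⊔ recordSigma P t] H)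
    {A : Set (Fin m → ℝ)} (hA : MeasurableSet A) :
    μ (H ∩ (fun ω => minVec (P ω) m t) ⁻¹' A)
      = ∫⁻ ω in H, scaledOrderStatLaw m (kthMin (P ω) (m + 1) t) A ∂μ := by
  have hX := hP.measurable_minVec m t
  have hZ := hP.isMeasurableConfig.measurable_kthMin (k := m + 1) (by omega) t
  have hκ : Measurable fun ω => scaledOrderStatLaw m (kthMin (P ω) (m + 1) t) :=
    (measurable_scaledOrderStatLaw m).comp hZ
  have h1 : (μ.restrict H).map (fun ω => minVec (P ω) m t)
      = (μ.restrict H).bind fun ω => scaledOrderStatLaw m (kthMin (P ω) (m + 1) t) := by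
    refine ext_of_forall_lintegral_eq_of_IsFiniteMeasure fun f => ?_
    have hf : Measurable fun u => (f u : ENNReal) := by fun_prop
    rw [lintegral_map hf hX, Measure.lintegral_bind hκ.aemeasurable hf.aemeasurable]
    exact hP.setLIntegral_minVec ht hH f
  have h2 := congrArg (fun ν => ν A) h1
  rw [Measure.map_apply hX hA, Measure.restrict_apply (hX hA),
    Measure.bind_apply hA hκ.aemeasurable] at h2
  rw [inter_comm, h2]

end

/-- The proposed version is a function of the minimum at time t, which belongs to the path. Hence it
serves every σ-algebra between the path and the path with records, in particular both ends. -/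
theorem condExp_minVec {Ω : Type*} {m' : MeasurableSpace Ω} [mΩ : MeasurableSpace Ω] {μ : Measure Ω}
    {P : Ω → Set (ℝ × ℝ)} (hP : IsUnitPoissonQuadrant P μ) [IsProbabilityMeasure μ]
    {t : ℝ} (ht : 0 < t) {m : ℕ} (hle : pathSigma P (m + 1) t ≤ m')
    (hle' : m' ≤ pathSigma P (m + 1) t ⊔ recordSigma P t)
    {A : Set (Fin m → ℝ)} (hA : MeasurableSet A) :
    μ⟦(fun ω => minVec (P ω) m t) ⁻¹' A | m'⟧
      =ᵐ[μ] fun ω => (scaledOrderStatLaw m (kthMin (P ω) (m + 1) t)).real A := by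
  have hX := hP.measurable_minVec m t
  have hm' : m' ≤ mΩ :=
    hle'.trans (sup_le (hP.pathSigma_le (by omega) t) (hP.recordSigma_le t))
  have hZ : Measurable[m'] fun ω => kthMin (P ω) (m + 1) t :=
    (comap_measurable _).mono ((le_iSup₂_of_le (f := fun s (_ : s ∈ Ioc (0 : ℝ) t) =>
      MeasurableSpace.comap (fun ω => kthMin (P ω) (m + 1) s) inferInstance) t ⟨ht, le_rfl⟩
        le_rfl).trans hle) le_rfl
  have hκ : Measurable[m'] fun ω => scaledOrderStatLaw m (kthMin (P ω) (m + 1) t) A :=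
    ((Measure.measurable_coe hA).comp (measurable_scaledOrderStatLaw m)).comp hZ
  have hκr : Measurable[m'] fun ω => (scaledOrderStatLaw m (kthMin (P ω) (m + 1) t)).real A :=
    hκ.ennreal_toReal
  symm
  refine ae_eq_condExp_of_forall_setIntegral_eq hm' ?_ ?_ ?_ ?_
  · exact (integrable_const (1 : ℝ)).indicator (hX hA)
  · intro s hs _
    refine Integrable.integrableOn (Integrable.of_bound (C := 1)
      (hκr.mono hm' le_rfl).aestronglyMeasurable (Filter.Eventually.of_forall fun ω => ?_))
    rw [Real.norm_of_nonneg measureReal_nonneg]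
    exact measureReal_le_one
  · intro s hs _
    rw [integral_indicator (hX hA), setIntegral_const, smul_eq_mul, mul_one, measureReal_def,
      Measure.restrict_apply (hX hA), inter_comm, hP.measure_inter_minVec ht (hle' s hs) hA]
    refine integral_toReal (hκ.mono hm' le_rfl).aemeasurable
      (Filter.Eventually.of_forall fun ω => measure_lt_top _ _)
  · exact hκr.aestronglyMeasurable

end IsUnitPoissonQuadrant

theorem lemma1 {Ω : Type*} [mΩ : MeasurableSpace Ω] (μ : Measure Ω) [IsProbabilityMeasure μ]
    (P : Ω → Set (ℝ × ℝ)) (hP : IsUnitPoissonQuadrant P μ)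
    (k : ℕ) (hk : 1 ≤ k) (t : ℝ) (ht : 0 < t) :
    -- the conditioning path, the smaller minima and the record times are measurable
    pathSigma P k t ≤ mΩ ∧
    Measurable (fun ω => smallerMinima (P ω) k t) ∧
    recordSigma P t ≤ mΩ ∧
    -- conditional independence of the smaller minima and the record times
    CondIndepSigma (pathSigma P k t)
      (MeasurableSpace.comap (fun ω => smallerMinima (P ω) k t) inferInstance)
      (recordSigma P t) μ ∧
    -- the conditional law of the smaller minima
    ∀ A : Set (Fin (k - 1) → ℝ), MeasurableSet A →
      μ⟦(fun ω => smallerMinima (P ω) k t) ⁻¹' A | pathSigma P k t⟧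
        =ᵐ[μ] fun ω => (uniformOrderStatLaw (k - 1) (kthMin (P ω) k t)).real A := by
  obtain ⟨m, rfl⟩ : ∃ m, k = m + 1 := ⟨k - 1, by omega⟩
  have hX : Measurable fun ω => smallerMinima (P ω) (m + 1) t := hP.measurable_minVec m t
  have hpath := hP.pathSigma_le hk t
  have hrec := hP.recordSigma_le t
  refine ⟨hpath, hX, hrec, ?_, ?_⟩
  · refine condIndepSigma_of_condExp_sup hpath hX.comap_le hrec ?_
    rintro _ ⟨A, hA, rfl⟩
    exact (hP.condExp_minVec ht le_sup_left le_rfl hA).trans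
      (hP.condExp_minVec ht le_rfl le_sup_left hA).symm
  · intro A hA
    refine (hP.condExp_minVec ht le_rfl le_sup_left hA).trans ?_
    -- The scaled law is identified with the conditioned uniform law only at positive levels.
    filter_upwards [hP.ae_kthMin_pos ht hk] with ω hω
    exact congrArg (fun ν : Measure (Fin m → ℝ) => ν.real A) (uniformOrderStatLaw_eq_map m hω).symm
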